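/- Notation. $H_{n,m}$ is the space of real forms of degree $m$ in $n$ variables, $P_{n,2d}\subset H_{n,2d}$ the cone of nonnegative forms, $\Sigma_{n,2d}$ the cone of sums of squares of forms in $H_{n,d}$, and $\Sigma_{n,2d}^*=\{\,l\in H_{n,2d}^\vee : l\ge 0 \text{ on } \Sigma_{n,2d}\,\}$; $\partial$ is the topological boundary in $H_{n,2d}$. $\mathcal V(p)$ is the real projective zero set of $p$. Projective points are given by nonzero representatives $v_j\in\mathbb R^n$. A Cayley–Bacharach relation on $v_1,\dots,v_N$ for forms of degree $d$ is a vector $0\neq u\in\mathbb R^N$ with $\sum_j u_j f(v_j)=0$ for all $f\in H_{n,d}$. (a) Let $p\in\partial P_{3,6}\setminus\Sigma_{3,6}$ and let $A=\{v_1,\dots,v_9\}\subset\mathbb R^3$ represent nine distinct projective points such that: $\mathcal V(p)=\{v_1,\dots,v_7\}$; the common zero set in $\mathbb P^2(\mathbb C)$ of some two real ternary cubics is exactly $\{v_1,\dots,v_9\}$; no four of the $v_j$ lie on a line and no seven on a conic. Then: 1. There is a Cayley–Bacharach relation $u$ on $A$ for ternary cubics; it is unique up to scaling and all $u_j\neq0$.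 2. If $u_8^2\,p(v_8)\neq u_9^2\,p(v_9)$, then there is $a\in\mathbb R^9$ such that $l_a:H_{3,6}\to\mathbb R$, $l_a(f)=\sum_{j=1}^9 a_jf(v_j)$, lies in $\Sigma_{3,6}^*$, satisfies $l_a(p)<0$ (so it certifies that $p$ is not a sum of squares), and spans an extreme ray of $\Sigma_{3,6}^*$. 3. (Genericity.) Let $S\subset H_{3,6}$ be the span of the products $gh$ of ternary cubics $g,h$ vanishing on $v_1,\dots,v_7$. Then $u_8^2\,p(v_8)=u_9^2\,p(v_9)$ if and only if $p\in S$, and $S$ is a proper subspace of the space of ternary sextics all of whose first partial derivatives vanish at $v_1,\dots,v_7$. In particular, if $p\notin S$, then every such completion $A$ of $\mathcal V(p)$ yields a certificate as in 2. (b) Let $p\in\partial P_{4,4}\setminus\Sigma_{4,4}$ and let $A=\{v_1,\dots,v_8\}\subset\mathbb R^4$ represent eight distinct projective points such that: $\mathcal V(p)=\{v_1,\dots,v_6\}$; the common zero set in $\mathbb P^3(\mathbb C)$ of some three real quaternary quadrics is exactly $\{v_1,\dots,v_8\}$; no five of the $v_j$ lie on a plane. Then there is a Cayley–Bacharach relation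 $u$ on $A$ for quaternary quadrics, unique up to scaling, with all $u_j\ne0$. If $u_7^2\,p(v_7)\neq u_8^2\,p(v_8)$, then there is $a\in\mathbb R^8$ such that $l_a(f)=\sum_{j=1}^8a_jf(v_j)$ lies in $\Sigma_{4,4}^*$, satisfies $l_a(p)<0$, and spans an extreme ray of $\Sigma_{4,4}^*$. Moreover $u_7^2\,p(v_7)=u_8^2\,p(v_8)$ if and only if $p$ lies in the span $S$ of the products $gh$ of quaternary quadrics vanishing on $v_1,\dots,v_6$, and $S$ is a proper subspace of the space of quaternary quartics all of whose first partial derivatives vanish at $v_1,\dots,v_6$. In particular, if $p\notin S$, then every such completion $A$ of $\mathcal V(p)$ yields a certificate. -/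

import Mathlib

/-- `H_{n,d}`: real forms (homogeneous polynomials, together with `0`) of degree `d` in `n`
variables. -/
abbrev Form (n d : ℕ) : Type := ↥(MvPolynomial.homogeneousSubmodule (Fin n) ℝ d)

namespace Form

/-- The usual topology of the finite-dimensional space of forms: convergence of coefficients. -/
instance coeffTopology (n d : ℕ) : TopologicalSpace (Form n d) :=
  TopologicalSpace.induced
    (fun (f : Form n d) (m : Fin n →₀ ℕ) => MvPolynomial.coeff m f.1) inferInstance

/-- Evaluation of forms at a point of `ℝⁿ`. -/
noncomputable def evalAt {n : ℕ} (d : ℕ) (x : Fin n → ℝ) : Form n d →ₗ[ℝ] ℝ :=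
  (MvPolynomial.aeval x).toLinearMap ∘ₗ (MvPolynomial.homogeneousSubmodule (Fin n) ℝ d).subtype

/-- The cone `P_{n,d}` of nonnegative forms. -/
def psdCone (n d : ℕ) : Set (Form n d) := {f | ∀ x : Fin n → ℝ, 0 ≤ evalAt d x f}

/-- The cone `Σ_{n,2d}` of sums of squares of forms of degree `d`. -/
def sosCone (n d : ℕ) : Set (Form n (2 * d)) :=
  {f | ∃ (r : ℕ) (g : Fin r → Form n d), f.1 = ∑ i, (g i).1 ^ 2}

/-- The dual cone `Σ_{n,2d}^*`, in the space of linear functionals on `H_{n,2d}`. -/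
noncomputable def sosDual (n d : ℕ) : PointedCone ℝ (Module.Dual ℝ (Form n (2 * d))) :=
  PointedCone.dual (Module.Dual.eval ℝ (Form n (2 * d))) (sosCone n d)

/-- The functional `f ↦ ∑ j, a j * f (v j)`. -/
noncomputable def pointFunctional {n N : ℕ} (d : ℕ) (v : Fin N → Fin n → ℝ) (a : Fin N → ℝ) :
    Module.Dual ℝ (Form n d) :=
  ∑ j, a j • evalAt d (v j)

/-- The nonnegative multiples of the nonzero functional `l` form an extreme ray of the cone. -/
def SpansExtremeRay {E : Type*} [AddCommGroup E] [Module ℝ E] (K : PointedCone ℝ E) (l : E) :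
    Prop :=
  l ≠ 0 ∧ (PointedCone.hull ℝ {l}).IsFaceOf K

/-- The vectors `v j` are nonzero and represent pairwise different projective points. -/
def DistinctProjectively {n N : ℕ} (v : Fin N → Fin n → ℝ) : Prop :=
  (∀ j, v j ≠ 0) ∧ ∀ i j, ∀ c : ℝ, v i = c • v j → i = j

/-- The real projective zero set of `p` consists precisely of the points `[v j]`. -/
def HasZeroSet {n d N : ℕ} (p : Form n d) (v : Fin N → Fin n → ℝ) : Prop :=
  ∀ x : Fin n → ℝ, x ≠ 0 → (evalAt d x p = 0 ↔ ∃ j, ∃ c : ℝ, x = c • v j)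

/-- No `k` of the points `v j` lie on a common hypersurface of degree `d`. -/
def NoneOnHypersurface {n N : ℕ} (k d : ℕ) (v : Fin N → Fin n → ℝ) : Prop :=
  ∀ S : Finset (Fin N), S.card = k →
    ∀ f : Form n d, (∀ j ∈ S, evalAt d (v j) f = 0) → f = 0

/-- The points `[v j]` are precisely the common zeros, in complex projective space, of `m` real
forms of degree `d`. -/
def IsIntersection {n N : ℕ} (m d : ℕ) (v : Fin N → Fin n → ℝ) : Prop :=
  ∃ q : Fin m → Form n d, ∀ z : Fin n → ℂ, z ≠ 0 →
    ((∀ i, MvPolynomial.aeval z (q i).1 = 0) ↔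
      ∃ j, ∃ c : ℂ, z = c • fun i => ((v j i : ℝ) : ℂ))

/-- `u` holds the coefficients of a nontrivial linear relation between the values at the points
`v j` of all forms of degree `d`. -/
def IsCayleyBacharach {n N : ℕ} (d : ℕ) (v : Fin N → Fin n → ℝ) (u : Fin N → ℝ) : Prop :=
  u ≠ 0 ∧ ∀ f : Form n d, ∑ j, u j * evalAt d (v j) f = 0

/-- The span, in `H_{n,2d}`, of the products `g * h` of forms `g`, `h` of degree `d` that vanish
at all the points `v j`. -/
noncomputable def productSpan {n N : ℕ} (d : ℕ) (v : Fin N → Fin n → ℝ) :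
    Submodule ℝ (Form n (2 * d)) :=
  Submodule.span ℝ {f | ∃ g h : Form n d,
    (∀ j, evalAt d (v j) g = 0) ∧ (∀ j, evalAt d (v j) h = 0) ∧ f.1 = g.1 * h.1}

/-- The forms of degree `d` all of whose first partial derivatives vanish at all the points
`v j`. -/
noncomputable def singularForms {n N : ℕ} (d : ℕ) (v : Fin N → Fin n → ℝ) :
    Submodule ℝ (Form n d) :=
  ⨅ (j : Fin N) (i : Fin n), LinearMap.ker
    ((MvPolynomial.aeval (v j)).toLinearMap ∘ₗ (MvPolynomial.pderiv (R := ℝ) i).toLinearMap ∘ₗ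
      (MvPolynomial.homogeneousSubmodule (Fin n) ℝ d).subtype)

end Form

/-! Both parts are one statement about K + 2 points cut out by n - 1 forms `q i` of degree d in n
variables. All the geometry needed is collected in `IsCayleyBacharachConfig`: a nontrivial relation
between values exists and none misses a point, and the forms of degree d and 2d through the points
are generated by the `q i`. Hence the value vectors of forms of degree d fill exactly the hyperplane
orthogonal to u.

Certificates. On squares, l_a is the diagonal quadratic form ∑ a_j x_j² on that hyperplane. If
exactly one a_k is negative and ∑ u_j²/a_j = 0, Cauchy–Schwarz makes it nonnegative, and it
degenerates at x_j = u_j/a_j. Any functional below it in the dual cone kills all multiples of the `q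
i`, so it is a point functional; it also kills the multiples of the degenerate form, which fixes its
coefficients up to scale (`certificate`). Since p vanishes at the first K points, only the two extra
ones contribute to l_a(p). The balance condition can be met with coefficients close to -u_k² and
u_l² there and large ones elsewhere, so a strict inequality between the two weighted values gives
l_a(p) < 0 (`exists_certificate_of_lt`).

Genericity. A form of degree d through the first K points has opposite u-weighted values at the two
extra points, so products of such forms satisfy the equality. Conversely, the equality lets one
subtract a multiple of one square e² so that p - c e² vanishes at all points and equals ∑ f_i q_i.
Since p is singular at the first K points and the intersection is transverse (`transverse`), every
f_i vanishes there (`mem_productSpan_iff`). Properness of S is a dimension count (`productSpan_lt`).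

Verifying the configuration. Testing a relation on reducible cubics or quadrics shows that it cannot
miss a point (`cubic_relation_head`, `quadric_relation_head`). Generation in degree 2d follows from
a lower bound on the dimension of the ideal (`isCayleyBacharachConfig`). For two cubics, the only
syzygy in that degree is the obvious one (`exists_eq_smul_of_syzygy`), seen by restriction to lines.
For three quadrics, the functionals annihilating the ideal are bounded by contraction with a linear
form h that avoids the points: modulo the quadrics and h the dimensions in degrees 2, 3, 4 are 3, at
most 1, and 0. The necessary complex zeros come from singular members of real pencils in odd
dimension and from binary quadratics. -/

namespace Form

open MvPolynomial Module

variable {n : ℕ}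

/-! ### Products, evaluation and dimensions of spaces of forms. -/

theorem evalAt_apply {d : ℕ} (x : Fin n → ℝ) (f : Form n d) : evalAt d x f = aeval x f.1 := rfl

/-- The product of two forms, as a bilinear map. -/
noncomputable def mul {a b c : ℕ} (h : a + b = c) : Form n a →ₗ[ℝ] Form n b →ₗ[ℝ] Form n c :=
  LinearMap.mk₂ ℝ (fun f g => ⟨f.1 * g.1, h ▸ IsHomogeneous.mul f.2 g.2⟩)
    (fun _ _ _ => Subtype.ext (add_mul _ _ _))
    (fun _ _ _ => Subtype.ext (smul_mul_assoc _ _ _))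
    (fun _ _ _ => Subtype.ext (mul_add _ _ _))
    (fun _ _ _ => Subtype.ext (mul_smul_comm _ _ _))

theorem coe_mul {a b c : ℕ} (h : a + b = c) (f : Form n a) (g : Form n b) :
    (mul h f g).1 = f.1 * g.1 := rfl

@[simp]
theorem evalAt_mul {a b c : ℕ} (h : a + b = c) (f : Form n a) (g : Form n b) (x : Fin n → ℝ) :
    evalAt c x (mul h f g) = evalAt a x f * evalAt b x g := by
  simp [evalAt_apply, coe_mul]

theorem ext_evalAt {d : ℕ} {f g : Form n d} (h : ∀ x, evalAt d x f = evalAt d x g) : f = g := by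
  refine Subtype.ext (MvPolynomial.funext fun x => ?_)
  have := h x
  simpa [evalAt_apply, aeval_eq_eval] using this

theorem aeval_smul_point {d : ℕ} (c : ℂ) (x : Fin n → ℂ) (f : Form n d) :
    aeval (c • x) f.1 = c ^ d * aeval x f.1 := by
  rw [aeval_def, aeval_def, eval₂_eq', eval₂_eq', Finset.mul_sum]
  refine Finset.sum_congr rfl fun m hm => ?_
  have hd : ∑ i, m i = d := by
    have := f.2 (mem_support_iff.mp hm)
    rw [← this, Finsupp.weight_apply, Finsupp.sum_fintype] <;> simp
  simp only [Pi.smul_apply, smul_eq_mul, mul_pow, Finset.prod_mul_distrib,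
    Finset.prod_pow_eq_pow_sum, hd]
  ring

theorem aeval_ofReal {d : ℕ} (x : Fin n → ℝ) (f : Form n d) :
    aeval (fun i => (x i : ℂ)) f.1 = ((evalAt d x f : ℝ) : ℂ) := by
  rw [evalAt_apply, ← Complex.coe_algebraMap, ← aeval_algebraMap_apply]
  rfl

instance finiteDimensional (n d : ℕ) : FiniteDimensional ℝ (Form n d) :=
  Module.Finite.iff_fg.mpr (homogeneousSubmodule_fg (Fin n) ℝ d)

theorem finrank_eq (n d : ℕ) : finrank ℝ (Form n d) = (n + d - 1).choose d := by
  have h := homogeneousSubmodule_eq_finsupp_supported (Fin n) ℝ d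
  have e : {m : Fin n →₀ ℕ | m.degree = d} =
      ↑(Finset.finsuppAntidiag (Finset.univ : Finset (Fin n)) d) := by
    ext m
    simp [Finset.mem_finsuppAntidiag, Finsupp.degree_eq_sum]
  rw [e] at h
  have e2 : finrank ℝ (Form n d) =
      (Finset.finsuppAntidiag (Finset.univ : Finset (Fin n)) d).card := by
    unfold Form
    rw [h]
    rw [LinearEquiv.finrank_eq (AddMonoidAlgebra.supportedEquivFinsupp _)]
    simp
  rw [e2, Finset.card_finsuppAntidiag_nat_eq_choose]
  simp

/-- Every form of positive degree is a sum of products with linear forms. -/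
theorem span_mul_linear (k : ℕ) {c : ℕ} (h : 1 + k = c) :
    Submodule.span ℝ {F : Form n c | ∃ (g : Form n 1) (f : Form n k), F = mul h g f} = ⊤ := by
  subst h
  rw [eq_top_iff]
  rintro F -
  -- Euler's identity, divided by the positive degree 1 + k, writes F as a sum of variables times
  -- partial derivatives.
  have hE : ∑ i : Fin n, X i * pderiv i F.1 = (1 + k) • F.1 := IsHomogeneous.sum_X_mul_pderiv F.2
  have hF : F = ((1 + k : ℝ)⁻¹) • ∑ i : Fin n, mul rfl (⟨X i, isHomogeneous_X ℝ i⟩ : Form n 1)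
      (⟨pderiv i F.1, by simpa using IsHomogeneous.pderiv (i := i) F.2⟩ : Form n k) := by
    apply Subtype.ext
    rw [Submodule.coe_smul, Submodule.coe_sum]
    simp only [coe_mul]
    rw [hE, ← Nat.cast_smul_eq_nsmul ℝ, smul_smul]
    push_cast
    rw [inv_mul_cancel₀ (by positivity), one_smul]
  rw [hF]
  exact Submodule.smul_mem _ _ (Submodule.sum_mem _ fun i _ => Submodule.subset_span ⟨_, _, rfl⟩)

/-- Reduces linear identities on forms to products with a linear factor, where they become formal.
-/
theorem induction_mul_linear {k c : ℕ} (h : 1 + k = c) {P : Form n c → Prop}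
    (h0 : P 0) (hadd : ∀ f g, P f → P g → P (f + g)) (hsmul : ∀ (a : ℝ) f, P f → P (a • f))
    (hmul : ∀ (g : Form n 1) (f : Form n k), P (mul h g f)) (F : Form n c) : P F := by
  have hF : F ∈ Submodule.span ℝ
      {F : Form n c | ∃ (g : Form n 1) (f : Form n k), F = mul h g f} := by
    rw [span_mul_linear]; trivial
  induction hF using Submodule.span_induction with
  | mem x hx => obtain ⟨g, f, rfl⟩ := hx; exact hmul g f
  | zero => exact h0
  | add f g _ _ hf hg => exact hadd f g hf hg
  | smul a f _ hf => exact hsmul a f hf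

end Form

/-! ### Linear forms, interpolation of values, restriction to lines and singular zeros. -/

namespace Form

open MvPolynomial Module

variable {n : ℕ}

/-- Linear forms are the same as linear functionals. -/
noncomputable def ofDual : Dual ℝ (Fin n → ℝ) →ₗ[ℝ] Form n 1 where
  toFun φ := ⟨∑ i, C (φ (Pi.single i 1)) * X i, Submodule.sum_mem _ fun i _ => by
    simpa using isHomogeneous_C_mul_X (φ (Pi.single i 1)) i⟩
  map_add' φ ψ := Subtype.ext (by simp [add_mul, Finset.sum_add_distrib])
  map_smul' c φ := Subtype.ext (by simp [Finset.mul_sum, mul_assoc, smul_eq_C_mul])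

@[simp]
theorem evalAt_ofDual (φ : Dual ℝ (Fin n → ℝ)) (x : Fin n → ℝ) :
    evalAt 1 x (ofDual φ) = φ x := by
  have hx : x = ∑ i, x i • (Pi.single i (1 : ℝ) : Fin n → ℝ) := by
    ext j; simp [Finset.sum_apply, Pi.single_apply]
  conv_rhs => rw [hx]
  simp [evalAt_apply, ofDual, mul_comm]

theorem aeval_linear_combination (g : Form n 1) (a b : ℂ) (x y : Fin n → ℂ) :
    aeval (a • x + b • y) g.1 = a * aeval x g.1 + b * aeval y g.1 := by
  have hg : g.1 ∈ Submodule.span ℝ (Set.range (X : Fin n → MvPolynomial (Fin n) ℝ)) := by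
    rw [← homogeneousSubmodule_one_eq_span_X]; exact g.2
  generalize g.1 = G at hg ⊢
  induction hg using Submodule.span_induction with
  | mem p hp => obtain ⟨i, rfl⟩ := hp; simp
  | zero => simp
  | add p q _ _ hp hq => simp only [map_add, hp, hq]; ring
  | smul c p _ hp => simp only [map_smul, hp, Complex.real_smul]; ring

theorem evalAt_linear_combination (g : Form n 1) (a b : ℝ) (x y : Fin n → ℝ) :
    evalAt 1 (a • x + b • y) g = a * evalAt 1 x g + b * evalAt 1 y g := by
  have h := aeval_linear_combination g a b (fun i => (x i : ℂ)) (fun i => (y i : ℂ))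
  have e : ((a : ℂ) • fun i => (x i : ℂ)) + ((b : ℂ) • fun i => (y i : ℂ)) =
      fun i => (((a • x + b • y) i : ℝ) : ℂ) := by
    ext i; simp
  rw [e] at h
  simp only [aeval_ofReal] at h
  exact_mod_cast h

/-- The linear functional given by a linear form. -/
noncomputable def toDual (g : Form n 1) : Dual ℝ (Fin n → ℝ) where
  toFun x := evalAt 1 x g
  map_add' x y := by simpa using evalAt_linear_combination g 1 1 x y
  map_smul' c x := by simpa using evalAt_linear_combination g c 0 x 0

@[simp]
theorem toDual_apply (g : Form n 1) (x : Fin n → ℝ) : toDual g x = evalAt 1 x g := rfl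

/-- The space of linear forms is dual to `ℝⁿ`. -/
noncomputable def dualEquiv (n : ℕ) : Form n 1 ≃ₗ[ℝ] Dual ℝ (Fin n → ℝ) where
  toFun := toDual
  map_add' f g := by ext; simp
  map_smul' c f := by ext; simp
  invFun := ofDual
  left_inv f := ext_evalAt fun x => by simp
  right_inv φ := LinearMap.ext fun x => by simp

/-- A linear form that vanishes at `x` but not at `y`. -/
theorem exists_linear_separating {x y : Fin n → ℝ} (h : ∀ c : ℝ, y ≠ c • x) :
    ∃ g : Form n 1, evalAt 1 x g = 0 ∧ evalAt 1 y g ≠ 0 := by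
  have hy : y ∉ Submodule.span ℝ {x} := by
    rw [Submodule.mem_span_singleton]
    rintro ⟨c, hc⟩
    exact h c hc.symm
  obtain ⟨φ, h1, h2⟩ := Submodule.exists_dual_map_eq_bot_of_notMem hy inferInstance
  refine ⟨ofDual φ, ?_, by simpa using h1⟩
  have : φ x ∈ Submodule.map φ (Submodule.span ℝ {x}) :=
    Submodule.mem_map_of_mem (Submodule.mem_span_singleton_self x)
  rw [h2] at this
  simpa using this

theorem exists_linear_ne_zero {y : Fin n → ℝ} (h : y ≠ 0) :
    ∃ g : Form n 1, evalAt 1 y g ≠ 0 := by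
  obtain ⟨g, -, hg⟩ := exists_linear_separating (x := 0) (y := y) (by simpa using h)
  exact ⟨g, hg⟩

/-- A value vector is attained by a form if it satisfies all linear relations between the values
of forms. -/
theorem exists_evalAt_eq {ι : Type*} [Fintype ι] [DecidableEq ι] {d : ℕ} (v : ι → Fin n → ℝ)
    (x : ι → ℝ) (h : ∀ w : ι → ℝ, (∀ f : Form n d, ∑ j, w j * evalAt d (v j) f = 0) →
      ∑ j, w j * x j = 0) : ∃ f : Form n d, ∀ j, evalAt d (v j) f = x j := by
  by_contra H
  let E : Form n d →ₗ[ℝ] (ι → ℝ) := LinearMap.pi fun j => evalAt d (v j)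
  have hx : x ∉ LinearMap.range E := by
    rintro ⟨f, hf⟩
    exact H ⟨f, fun j => congrFun hf j⟩
  -- A functional separating x from the attained value vectors is itself a relation, and it is not
  -- orthogonal to x.
  obtain ⟨φ, h1, h2⟩ := Submodule.exists_dual_map_eq_bot_of_notMem hx inferInstance
  have hφ : ∀ y : ι → ℝ, φ y = ∑ j, φ (Pi.single j 1) * y j := by
    intro y
    have hy : y = ∑ i, y i • (Pi.single i (1 : ℝ) : ι → ℝ) := by
      ext j; simp [Finset.sum_apply, Pi.single_apply]
    conv_lhs => rw [hy]
    simp [mul_comm]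
  apply h1
  rw [hφ]
  refine h _ fun f => ?_
  have : φ (E f) ∈ Submodule.map φ (LinearMap.range E) :=
    Submodule.mem_map_of_mem (LinearMap.mem_range_self E f)
  rw [h2, Submodule.mem_bot, hφ] at this
  exact this

/-- Points without relations impose independent conditions. -/
theorem finrank_vanishing {ι : Type*} [Fintype ι] [DecidableEq ι] {d : ℕ} (v : ι → Fin n → ℝ)
    (h : ∀ w : ι → ℝ, (∀ f : Form n d, ∑ j, w j * evalAt d (v j) f = 0) → w = 0) :
    finrank ℝ (LinearMap.ker (LinearMap.pi fun j => evalAt d (v j))) + Fintype.card ι =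
      finrank ℝ (Form n d) := by
  have hs : Function.Surjective (LinearMap.pi fun j => evalAt d (v j)) := by
    intro x
    obtain ⟨f, hf⟩ := exists_evalAt_eq v x fun w hw => by simp [h w hw]
    exact ⟨f, funext hf⟩
  rw [← LinearMap.finrank_range_add_finrank_ker (LinearMap.pi fun j => evalAt d (v j)),
    LinearMap.range_eq_top.mpr hs, finrank_top, finrank_fintype_fun_eq_card, add_comm]

/-- The derivative at `x` in the direction `t`. -/
noncomputable def dirDeriv (x t : Fin n → ℝ) : MvPolynomial (Fin n) ℝ →ₗ[ℝ] ℝ :=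
  ∑ i, t i • ((aeval x).toLinearMap ∘ₗ (pderiv (R := ℝ) i).toLinearMap)

theorem dirDeriv_apply (x t : Fin n → ℝ) (f : MvPolynomial (Fin n) ℝ) :
    dirDeriv x t f = ∑ i, t i * aeval x (pderiv i f) := by
  simp [dirDeriv]

theorem dirDeriv_mul (x t : Fin n → ℝ) (f g : MvPolynomial (Fin n) ℝ) :
    dirDeriv x t (f * g) = aeval x f * dirDeriv x t g + aeval x g * dirDeriv x t f := by
  simp only [dirDeriv_apply, Derivation.leibniz, map_add, smul_eq_mul, map_mul, Finset.mul_sum,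
    ← Finset.sum_add_distrib]
  exact Finset.sum_congr rfl fun i _ => by ring

theorem dirDeriv_linear (x t : Fin n → ℝ) (g : Form n 1) : dirDeriv x t g.1 = evalAt 1 t g := by
  have hg : g.1 ∈ Submodule.span ℝ (Set.range (X : Fin n → MvPolynomial (Fin n) ℝ)) := by
    rw [← homogeneousSubmodule_one_eq_span_X]; exact g.2
  rw [evalAt_apply]
  generalize g.1 = G at hg ⊢
  induction hg using Submodule.span_induction with
  | mem p hp =>
    obtain ⟨i, rfl⟩ := hp
    simp [dirDeriv_apply, pderiv_X, Pi.single_apply, apply_ite]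
  | zero => simp
  | add p q _ _ hp hq => simp only [map_add, hp, hq]
  | smul c p _ hp => simp only [map_smul, hp]

/-- The restriction of polynomials to a line, as univariate polynomials. -/
noncomputable def lineRestrict (x t : Fin n → ℝ) : MvPolynomial (Fin n) ℝ →ₐ[ℝ] Polynomial ℝ :=
  aeval fun i => Polynomial.C (x i) + Polynomial.C (t i) * Polynomial.X

theorem aeval_lineRestrict {A : Type*} [CommRing A] [Algebra ℝ A] (x t : Fin n → ℝ)
    (f : MvPolynomial (Fin n) ℝ) (s : A) :
    Polynomial.aeval s (lineRestrict x t f) =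
      aeval (fun i => algebraMap ℝ A (x i) + algebraMap ℝ A (t i) * s) f := by
  have : (Polynomial.aeval s).comp (lineRestrict x t) =
      aeval (fun i => algebraMap ℝ A (x i) + algebraMap ℝ A (t i) * s) :=
    MvPolynomial.algHom_ext fun i => by simp [lineRestrict]
  exact DFunLike.congr_fun this f

theorem eval_lineRestrict (x t : Fin n → ℝ) (f : MvPolynomial (Fin n) ℝ) (s : ℝ) :
    (lineRestrict x t f).eval s = aeval (x + s • t) f := by
  rw [← Polynomial.coe_aeval_eq_eval, aeval_lineRestrict]
  congr 2
  ext i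
  simp [mul_comm]

theorem derivative_lineRestrict (x t : Fin n → ℝ) (f : MvPolynomial (Fin n) ℝ) :
    (Polynomial.derivative (lineRestrict x t f)).eval 0 = dirDeriv x t f := by
  induction f using MvPolynomial.induction_on with
  | C a => simp [dirDeriv_apply, lineRestrict, Polynomial.algebraMap_eq]
  | add p q hp hq => simp only [map_add, Polynomial.eval_add, hp, hq]
  | mul_X p i hp =>
    rw [map_mul, Polynomial.derivative_mul, Polynomial.eval_add, Polynomial.eval_mul,
      Polynomial.eval_mul, hp, eval_lineRestrict, eval_lineRestrict, dirDeriv_mul,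
          zero_smul, add_zero]
    simp [dirDeriv_apply, pderiv_X, Pi.single_apply, apply_ite, lineRestrict]
    ring

/-- A nonnegative form is singular at its zeros. -/
theorem dirDeriv_eq_zero_of_nonneg {d : ℕ} {p : Form n d} (hp : ∀ x, 0 ≤ evalAt d x p)
    {x : Fin n → ℝ} (hx : evalAt d x p = 0) (t : Fin n → ℝ) : dirDeriv x t p.1 = 0 := by
  rw [← derivative_lineRestrict]
  set P := lineRestrict x t p.1
  have hmin : IsLocalMin (fun s => P.eval s) 0 := by
    refine Filter.Eventually.of_forall fun s => ?_
    simp only [P, eval_lineRestrict, zero_smul, add_zero]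
    have := hp (x + s • t)
    rw [evalAt_apply] at this hx
    rwa [hx]
  exact hmin.hasDerivAt_eq_zero (P.hasDerivAt 0)

theorem mem_singularForms {d N : ℕ} {v : Fin N → Fin n → ℝ} {f : Form n d} :
    f ∈ singularForms d v ↔ ∀ j t, dirDeriv (v j) t f.1 = 0 := by
  simp only [singularForms, Submodule.mem_iInf, LinearMap.mem_ker]
  constructor
  · intro h j t
    rw [dirDeriv_apply]
    exact Finset.sum_eq_zero fun i _ =>
        by rw [show aeval (v j) (pderiv i f.1) = 0 from h j i, mul_zero]
  · intro h j i
    have := h j (Pi.single i 1)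
    simpa [dirDeriv_apply, Pi.single_apply] using this

/-- Euler's identity recovers d times the value from the first partial derivatives. -/
theorem evalAt_eq_zero_of_mem_singularForms {d N : ℕ} (hd : d ≠ 0) {v : Fin N → Fin n → ℝ}
    {f : Form n d} (hf : f ∈ singularForms d v) (j : Fin N) : evalAt d (v j) f = 0 := by
  have h := congrArg (aeval (v j)) (IsHomogeneous.sum_X_mul_pderiv f.2)
  simp only [map_sum, map_mul, aeval_X, map_nsmul] at h
  rw [← dirDeriv_apply, mem_singularForms.mp hf, nsmul_eq_mul] at h
  simpa [hd, evalAt_apply] using h.symm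

/-- Singularity at N points amounts to N * n linear conditions, which may be dependent. -/
theorem finrank_le_singularForms (d N : ℕ) (v : Fin N → Fin n → ℝ) :
    finrank ℝ (Form n d) ≤ finrank ℝ (singularForms d v) + N * n := by
  let E : Form n d →ₗ[ℝ] (Fin N × Fin n → ℝ) := LinearMap.pi fun ji =>
    (aeval (v ji.1)).toLinearMap ∘ₗ (pderiv (R := ℝ) ji.2).toLinearMap ∘ₗ
      (homogeneousSubmodule (Fin n) ℝ d).subtype
  have hE : LinearMap.ker E = singularForms d v := by
    rw [LinearMap.ker_pi, singularForms, iInf_prod]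
  have h1 := LinearMap.finrank_range_add_finrank_ker E
  have h2 := Submodule.finrank_le (LinearMap.range E)
  rw [hE] at h1
  simp at h2
  omega

/-- The only role of the topology: a form on the boundary of the cone still belongs to the cone. -/
theorem isClosed_psdCone (n d : ℕ) : IsClosed (psdCone n d) := by
  have : psdCone n d = ⋂ x, {f | 0 ≤ evalAt d x f} := by ext; simp [psdCone]
  rw [this]
  refine isClosed_iInter fun x => ?_
  suffices h : Continuous fun f : Form n d => evalAt d x f from isClosed_le continuous_const h
  have hc : ∀ m : Fin n →₀ ℕ, Continuous fun f : Form n d => coeff m f.1 := fun m =>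
    (continuous_apply m).comp continuous_induced_dom
  have he : (fun f : Form n d => evalAt d x f) = fun f : Form n d =>
      ∑ m ∈ Finset.finsuppAntidiag (Finset.univ : Finset (Fin n)) d,
        coeff m f.1 * ∏ i, x i ^ m i := by
    ext f
    rw [evalAt_apply, aeval_eq_eval]
    refine (eval_eq' x f.1).trans ?_
    refine Finset.sum_subset ?_ ?_
    · intro m hm
      have := f.2 (mem_support_iff.mp hm)
      simp only [Finset.mem_finsuppAntidiag, Finset.subset_univ, and_true]
      rw [← this, Finsupp.weight_apply, Finsupp.sum_fintype] <;> simp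
    · intro m _ hm
      rw [notMem_support_iff.mp hm, zero_mul]
  rw [he]
  exact continuous_finsetSum _ fun m _ => (hc m).mul continuous_const

theorem nonneg_of_mem_frontier {d : ℕ} {p : Form n d} (hp : p ∈ frontier (psdCone n d)) :
    ∀ x, 0 ≤ evalAt d x p :=
  (isClosed_psdCone n d).frontier_subset hp

end Form

/-! ### Cayley–Bacharach configurations and the extreme rays they produce. -/

namespace Form

open MvPolynomial Module

variable {n : ℕ}

/-- The properties of the points of intersection of `n - 1` forms `q i` of degree `d` in `n`
variables: any relation between the values at the points that misses a point is trivial, the forms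
of degree `d` and `2 * d` through the points are generated by the `q i`, and there is a
relation. -/
structure IsCayleyBacharachConfig {m : ℕ} (d K : ℕ) (v : Fin (K + 2) → Fin n → ℝ)
    (q : Fin m → Form n d) : Prop where
  distinct : DistinctProjectively v
  vanish : ∀ i j, evalAt d (v j) (q i) = 0
  span : ∀ f : Form n d, (∀ j, evalAt d (v j) f = 0) → f ∈ Submodule.span ℝ (Set.range q)
  noether : ∀ F : Form n (2 * d), (∀ j, evalAt (2 * d) (v j) F = 0) →
    ∃ f : Fin m → Form n d, F = ∑ i, mul (two_mul d).symm (f i) (q i)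
  indep : ∀ w : Fin (K + 2) → ℝ, (∀ f : Form n d, ∑ j, w j * evalAt d (v j) f = 0) →
    ∀ j, w j = 0 → w = 0
  exists_relation : ∃ u, IsCayleyBacharach d v u

theorem mem_sosCone_mul_self {d : ℕ} (f : Form n d) :
    mul (two_mul d).symm f f ∈ sosCone n d :=
  ⟨1, fun _ => f, by simp [coe_mul, sq]⟩

theorem mem_sosDual {d : ℕ} {l : Dual ℝ (Form n (2 * d))} :
    l ∈ sosDual n d ↔ ∀ f : Form n d, 0 ≤ l (mul (two_mul d).symm f f) := by
  simp only [sosDual, PointedCone.mem_dual, Dual.eval_apply]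
  constructor
  · intro h f
    exact h (mem_sosCone_mul_self f)
  · rintro h F ⟨r, g, hF⟩
    have : F = ∑ i, mul (two_mul d).symm (g i) (g i) := Subtype.ext (by
      rw [hF, Submodule.coe_sum]
      simp [coe_mul, sq])
    rw [this, map_sum]
    exact Finset.sum_nonneg fun i _ => h _

theorem pointFunctional_apply {N d : ℕ} (v : Fin N → Fin n → ℝ) (a : Fin N → ℝ) (f : Form n d) :
    pointFunctional d v a f = ∑ j, a j * evalAt d (v j) f := by
  simp [pointFunctional]

/-- Cauchy-Schwarz: a functional in the dual cone whose square vanishes on `g` kills the multiples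
of `g`. -/
theorem apply_mul_eq_zero {d : ℕ} {l : Dual ℝ (Form n (2 * d))} (hl : l ∈ sosDual n d)
    {g : Form n d} (hg : l (mul (two_mul d).symm g g) = 0) (f : Form n d) :
    l (mul (two_mul d).symm f g) = 0 := by
  have hcomm : mul (two_mul d).symm g f = mul (two_mul d).symm f g :=
    Subtype.ext (mul_comm _ _)
  have key : ∀ s : ℝ, 0 ≤ l (mul (two_mul d).symm f f) +
      s * (2 * l (mul (two_mul d).symm f g)) := by
    intro s
    have := mem_sosDual.mp hl (f + s • g)
    simp only [map_add, LinearMap.add_apply, map_smul, LinearMap.smul_apply, hcomm, hg,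
      smul_eq_mul] at this
    linarith
  by_contra hne
  set A := l (mul (two_mul d).symm f f)
  set B := l (mul (two_mul d).symm f g)
  -- At this s the affine function A + 2sB takes the value -1.
  have := key (-(A + 1) / (2 * B))
  rw [div_mul_cancel₀ _ (mul_ne_zero two_ne_zero hne)] at this
  linarith

namespace IsCayleyBacharachConfig

variable {m d K : ℕ} {v : Fin (K + 2) → Fin n → ℝ} {q : Fin m → Form n d}

theorem relation_ne_zero (C : IsCayleyBacharachConfig d K v q) {u : Fin (K + 2) → ℝ}
    (hu : IsCayleyBacharach d v u) (j : Fin (K + 2)) : u j ≠ 0 :=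
  fun h => hu.1 (C.indep u hu.2 j h)

theorem exists_smul_eq (C : IsCayleyBacharachConfig d K v q) {u w : Fin (K + 2) → ℝ}
    (hu : IsCayleyBacharach d v u) (hw : ∀ f : Form n d, ∑ j, w j * evalAt d (v j) f = 0) :
    ∃ c : ℝ, w = c • u := by
  refine ⟨w 0 / u 0, sub_eq_zero.mp (C.indep _ (fun f => ?_) 0 ?_)⟩
  · simp only [Pi.sub_apply, Pi.smul_apply, smul_eq_mul, sub_mul, mul_assoc,
      Finset.sum_sub_distrib, ← Finset.mul_sum, hw f, hu.2 f, mul_zero, sub_zero]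
  · simp [div_mul_cancel₀ _ (C.relation_ne_zero hu 0)]

/-- As all relations are multiples of u, orthogonality to u is the only obstruction to
interpolation. -/
theorem exists_evalAt (C : IsCayleyBacharachConfig d K v q) {u : Fin (K + 2) → ℝ}
    (hu : IsCayleyBacharach d v u) (x : Fin (K + 2) → ℝ) (hx : ∑ j, u j * x j = 0) :
    ∃ f : Form n d, ∀ j, evalAt d (v j) f = x j := by
  refine exists_evalAt_eq v x fun w hw => ?_
  obtain ⟨c, rfl⟩ := C.exists_smul_eq hu hw
  simp [mul_assoc, ← Finset.mul_sum, hx]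

/-- A form of degree `d` that vanishes at all points but two. -/
theorem exists_evalAt_two (C : IsCayleyBacharachConfig d K v q) {u : Fin (K + 2) → ℝ}
    (hu : IsCayleyBacharach d v u) {j k : Fin (K + 2)} (hjk : j ≠ k) :
    ∃ f : Form n d, evalAt d (v j) f = u k ∧ evalAt d (v k) f = - u j ∧
      ∀ i, i ≠ j → i ≠ k → evalAt d (v i) f = 0 := by
  obtain ⟨f, hf⟩ := C.exists_evalAt hu (fun i => if i = j then u k else if i = k then -u j else 0)
    (by
      rw [← Finset.add_sum_erase _ _ (Finset.mem_univ j),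
        ← Finset.add_sum_erase _ _ (Finset.mem_erase.mpr ⟨hjk.symm, Finset.mem_univ k⟩),
        Finset.sum_eq_zero]
      · simp [hjk.symm]; ring
      · intro i hi
        simp only [Finset.mem_erase] at hi
        simp [hi.1, hi.2.1])
  refine ⟨f, by simp [hf], by simp [hf, hjk.symm], fun i hj hk => by simp [hf, hj, hk]⟩

/-- A point functional with one negative coefficient whose coefficients balance the relation spans
an extreme ray of the dual cone. -/
theorem certificate (C : IsCayleyBacharachConfig d K v q) (hK : 1 ≤ K) {u : Fin (K + 2) → ℝ}
    (hu : IsCayleyBacharach d v u) (a : Fin (K + 2) → ℝ) (k : Fin (K + 2)) (hk : a k < 0)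
    (ha : ∀ j, j ≠ k → 0 < a j) (hsum : ∑ j, u j ^ 2 / a j = 0) :
    pointFunctional (2 * d) v a ∈ sosDual n d ∧
      SpansExtremeRay (sosDual n d) (pointFunctional (2 * d) v a) := by
  have ha0 : ∀ j, a j ≠ 0 := fun j => by
    by_cases h : j = k
    · exact h ▸ hk.ne
    · exact (ha j h).ne'
  have hpsd : pointFunctional (2 * d) v a ∈ sosDual n d := by
    rw [mem_sosDual]
    intro f
    rw [pointFunctional_apply]
    simp only [evalAt_mul]
    set x : Fin (K + 2) → ℝ := fun j => evalAt d (v j) f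
    have hx : ∑ j, u j * x j = 0 := hu.2 f
    rw [← Finset.add_sum_erase _ _ (Finset.mem_univ k)] at hx hsum ⊢
    -- Cauchy–Schwarz for u_j x_j = (u_j/√a_j)(√a_j x_j) over the positive coefficients. The
    -- relation turns the left side into (u_k x_k)², the balance condition turns one factor on the
    -- right into -u_k²/a_k.
    have hcs := Finset.sum_sq_le_sum_mul_sum_of_sq_le_mul (Finset.univ.erase k)
      (f := fun j => u j ^ 2 / a j) (g := fun j => a j * (x j * x j)) (r := fun j => u j * x j)
      (fun j hj => div_nonneg (sq_nonneg _) (ha j (Finset.ne_of_mem_erase hj)).le)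
      (fun j hj => mul_nonneg (ha j (Finset.ne_of_mem_erase hj)).le (mul_self_nonneg _))
      (fun j _ => by have := ha0 j; exact le_of_eq (by field_simp))
    set S := ∑ j ∈ Finset.univ.erase k, a j * (x j * x j)
    rw [show ∑ j ∈ Finset.univ.erase k, u j * x j = - (u k * x k) by linarith,
      show ∑ j ∈ Finset.univ.erase k, u j ^ 2 / a j = - (u k ^ 2 / a k) by linarith] at hcs
    have huk : 0 < u k ^ 2 := by have := C.relation_ne_zero hu k; positivity
    have h1 : u k ^ 2 * (a k * (x k * x k) + S) ≥ 0 := by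
      have h2 := mul_le_mul_of_nonneg_left hcs (neg_nonneg.mpr hk.le)
      have h3 : -a k * (-(u k ^ 2 / a k) * S) = u k ^ 2 * S := by
        have := hk.ne
        field_simp
      rw [h3] at h2
      nlinarith
    exact nonneg_of_mul_nonneg_right h1 huk
  obtain ⟨j₁, j₂, h12, h1k, h2k⟩ : ∃ j₁ j₂ : Fin (K + 2), j₁ ≠ j₂ ∧ j₁ ≠ k ∧ j₂ ≠ k := by
    have hc : 1 < (Finset.univ.erase k).card := by
      rw [Finset.card_erase_of_mem (Finset.mem_univ k), Finset.card_univ, Fintype.card_fin]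
      omega
    obtain ⟨j₁, h1, j₂, h2, h12⟩ := Finset.one_lt_card.mp hc
    exact ⟨j₁, j₂, h12, Finset.ne_of_mem_erase h1, Finset.ne_of_mem_erase h2⟩
  -- A form supported at two points with positive coefficients: the value on its square is positive,
  -- which shows that the functional is nonzero and later fixes the sign of the scale factor.
  obtain ⟨e, he1, he2, he⟩ := C.exists_evalAt_two hu h12
  have hpos : 0 < pointFunctional (2 * d) v a (mul (two_mul d).symm e e) := by
    rw [pointFunctional_apply, ← Finset.add_sum_erase _ _ (Finset.mem_univ j₁),
      ← Finset.add_sum_erase _ _ (Finset.mem_erase.mpr ⟨h12.symm, Finset.mem_univ j₂⟩),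
      Finset.sum_eq_zero]
    · simp only [evalAt_mul, he1, he2]
      have := mul_pos (ha j₁ h1k) (mul_self_pos.mpr (C.relation_ne_zero hu j₂))
      have := mul_pos (ha j₂ h2k) (mul_self_pos.mpr (C.relation_ne_zero hu j₁))
      linarith
    · intro i hi
      simp only [Finset.mem_erase] at hi
      simp [he i hi.2.1 hi.1]
  refine ⟨hpsd, fun h => by simp [h] at hpos, ?_, ?_⟩
  · exact Submodule.span_le.mpr (by simpa using hpsd)
  intro l₁ l₂ c hl₁ hl₂ hc hmem
  obtain ⟨t, ht⟩ := Submodule.mem_span_singleton.mp hmem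
  -- the kernel of the form defined by the functional is killed by `l₁`
  have hkill : ∀ g : Form n d, pointFunctional (2 * d) v a (mul (two_mul d).symm g g) = 0 →
      ∀ f, l₁ (mul (two_mul d).symm f g) = 0 := by
    intro g hg
    refine apply_mul_eq_zero hl₁ ?_
    have h1 := mem_sosDual.mp hl₁ g
    have h2 := mem_sosDual.mp hl₂ g
    have h3 := LinearMap.congr_fun ht (mul (two_mul d).symm g g)
    change (t : ℝ) * _ = c * _ + _ at h3
    rw [hg, mul_zero] at h3
    nlinarith
  -- The `q i` vanish at all points, so `l₁` kills their multiples; these are all forms of degree 2d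
  -- through the points, hence `l₁` is a combination of evaluations.
  obtain ⟨b, hb⟩ : ∃ b : Fin (K + 2) → ℝ, ∑ j, b j • evalAt (2 * d) (v j) = l₁ := by
    rw [← Submodule.mem_span_range_iff_exists_fun]
    refine mem_span_of_iInf_ker_le_ker fun F hF => ?_
    simp only [Submodule.mem_iInf, LinearMap.mem_ker] at hF ⊢
    obtain ⟨f, rfl⟩ := C.noether F hF
    rw [map_sum]
    refine Finset.sum_eq_zero fun i _ => hkill _ ?_ _
    simp [pointFunctional_apply, C.vanish]
  -- The equality case of Cauchy–Schwarz. These values are attained by a form precisely because of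
  -- the balance condition.
  obtain ⟨g, hg⟩ := C.exists_evalAt hu (fun j => u j / a j) (by
    rw [← hsum]; exact Finset.sum_congr rfl fun j _ => by ring)
  have hg0 : pointFunctional (2 * d) v a (mul (two_mul d).symm g g) = 0 := by
    rw [pointFunctional_apply, ← hsum]
    refine Finset.sum_congr rfl fun j _ => ?_
    have := ha0 j
    simp only [evalAt_mul, hg]
    field_simp
  -- Since `l₁` kills the multiples of g, the numbers b_j u_j / a_j form a relation; its uniqueness
  -- makes b proportional to a.
  obtain ⟨s, hs⟩ := C.exists_smul_eq hu (w := fun j => b j * (u j / a j)) fun f => by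
    have := hkill g hg0 f
    rw [← hb] at this
    simp only [LinearMap.sum_apply, LinearMap.smul_apply, evalAt_mul, hg, smul_eq_mul] at this
    rw [← this]
    exact Finset.sum_congr rfl fun j _ => by ring
  have hbs : ∀ j, b j = s * a j := fun j => by
    have h1 := congrFun hs j
    have := ha0 j
    have h2 := C.relation_ne_zero hu j
    simp only [Pi.smul_apply, smul_eq_mul] at h1
    field_simp at h1
    rw [h1, mul_comm]
  have hl : l₁ = s • pointFunctional (2 * d) v a := by
    rw [← hb, pointFunctional, Finset.smul_sum]
    exact Finset.sum_congr rfl fun j _ => by rw [hbs, mul_smul]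
  have hs0 : 0 ≤ s := by
    have := mem_sosDual.mp hl₁ e
    rw [hl, LinearMap.smul_apply, smul_eq_mul] at this
    exact nonneg_of_mul_nonneg_left this hpos
  rw [hl]
  exact Submodule.mem_span_singleton.mpr ⟨⟨s, hs0⟩, rfl⟩

/-- The certificate with negative coefficient at the point `k`. -/
theorem exists_certificate_of_lt (C : IsCayleyBacharachConfig d K v q) (hK : 1 ≤ K)
    {u : Fin (K + 2) → ℝ} (hu : IsCayleyBacharach d v u) {p : Form n (2 * d)}
    {k l : Fin (K + 2)} (hkl : k ≠ l)
    (hp : ∀ j, j ≠ k → j ≠ l → evalAt (2 * d) (v j) p = 0)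
    (hl : 0 < evalAt (2 * d) (v l) p)
    (hlt : u l ^ 2 * evalAt (2 * d) (v l) p < u k ^ 2 * evalAt (2 * d) (v k) p) :
    ∃ a : Fin (K + 2) → ℝ, pointFunctional (2 * d) v a ∈ sosDual n d ∧
      pointFunctional (2 * d) v a p < 0 ∧
      SpansExtremeRay (sosDual n d) (pointFunctional (2 * d) v a) := by
  set pk := evalAt (2 * d) (v k) p
  set pl := evalAt (2 * d) (v l) p
  have huk := C.relation_ne_zero hu k
  have hul := C.relation_ne_zero hu l
  have hlk : l ∈ Finset.univ.erase k := Finset.mem_erase.mpr ⟨hkl.symm, Finset.mem_univ l⟩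
  set A := ∑ j ∈ (Finset.univ.erase k).erase l, u j ^ 2
  have hA : 0 < A := by
    refine Finset.sum_pos (fun j _ => by have := C.relation_ne_zero hu j; positivity) ?_
    rw [← Finset.card_pos, Finset.card_erase_of_mem hlk,
      Finset.card_erase_of_mem (Finset.mem_univ k), Finset.card_univ, Fintype.card_fin]
    omega
  obtain ⟨ε, hε, hεlt⟩ : ∃ ε : ℝ, 0 < ε ∧ (1 + ε) * (u l ^ 2 * pl) < u k ^ 2 * pk := by
    have hL : 0 < u l ^ 2 * pl := by positivity
    -- With this ε, (1 + ε) u_l² p(v_l) is the midpoint between the two weighted values.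
    refine ⟨(u k ^ 2 * pk - u l ^ 2 * pl) / (2 * (u l ^ 2 * pl)),
      div_pos (by linarith) (by linarith), ?_⟩
    have e : (u k ^ 2 * pk - u l ^ 2 * pl) / (2 * (u l ^ 2 * pl)) * (u l ^ 2 * pl) =
        (u k ^ 2 * pk - u l ^ 2 * pl) / 2 := by
      field_simp
    rw [add_mul, one_mul, e]
    linarith
  -- The terms of ∑ u_j²/a_j are -(1 + ε) at k and 1 at l, and the remaining ones add up to ε, so
  -- the total is 0.
  let a : Fin (K + 2) → ℝ := fun j =>
    if j = k then -(u k ^ 2 / (1 + ε)) else if j = l then u l ^ 2 else A / ε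
  have hak : a k = -(u k ^ 2 / (1 + ε)) := by simp [a]
  have hal : a l = u l ^ 2 := by simp [a, hkl.symm]
  have haj : ∀ j ∈ (Finset.univ.erase k).erase l, a j = A / ε := by
    intro j hj
    simp only [Finset.mem_erase] at hj
    simp [a, hj.1, hj.2.1]
  obtain ⟨h1, h2⟩ := C.certificate hK hu a k
    (by rw [hak]; exact neg_neg_of_pos (by positivity))
    (fun j hj => by
      by_cases hjl : j = l
      · rw [hjl, hal]; positivity
      · rw [haj j (by simp [hj, hjl])]; positivity)
    (by
      rw [← Finset.add_sum_erase _ _ (Finset.mem_univ k), ← Finset.add_sum_erase _ _ hlk,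
        Finset.sum_congr rfl fun j hj => by rw [haj j hj], ← Finset.sum_div, hak, hal]
      change _ + (_ + A / _) = 0
      field_simp
      ring)
  refine ⟨a, h1, ?_, h2⟩
  rw [pointFunctional_apply, ← Finset.add_sum_erase _ _ (Finset.mem_univ k),
    ← Finset.add_sum_erase _ _ hlk, Finset.sum_eq_zero, hak, hal, add_zero]
  · change -(u k ^ 2 / (1 + ε)) * pk + u l ^ 2 * pl < 0
    have : u l ^ 2 * pl < u k ^ 2 * pk / (1 + ε) := by
      rw [lt_div_iff₀ (by positivity)]; linarith
    have e : -(u k ^ 2 / (1 + ε)) * pk = -(u k ^ 2 * pk / (1 + ε)) := by ring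
    rw [e]; linarith
  · intro j hj
    simp only [Finset.mem_erase] at hj
    rw [hp j hj.2.1 hj.1, mul_zero]

end IsCayleyBacharachConfig

end Form

/-! ### Transversality, and the span of products inside the singular forms. -/

namespace Form

open MvPolynomial Module

variable {n : ℕ}

theorem dirDeriv_eq_zero_of_aeval (x t : Fin n → ℝ) {f g : MvPolynomial (Fin n) ℝ}
    (hf : aeval x f = 0) (hg : aeval x g = 0) : dirDeriv x t (f * g) = 0 := by
  rw [dirDeriv_mul, hf, hg, zero_mul, zero_mul, add_zero]

/-- The differential of a polynomial at a point. -/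
noncomputable def differential (x : Fin n → ℝ) (f : MvPolynomial (Fin n) ℝ) :
    Dual ℝ (Fin n → ℝ) where
  toFun t := dirDeriv x t f
  map_add' s t := by simp [dirDeriv_apply, add_mul, Finset.sum_add_distrib]
  map_smul' c t := by simp [dirDeriv_apply, mul_assoc, Finset.mul_sum]

namespace IsCayleyBacharachConfig

variable {m d K : ℕ} {v : Fin (K + 2) → Fin n → ℝ} {q : Fin m → Form n d}

/-- The intersection is transverse. -/
theorem transverse (C : IsCayleyBacharachConfig d K v q) (hm : m + 1 = n) (hd : 2 ≤ d)
    (j : Fin (K + 2)) (s : Fin m → ℝ) (hs : ∀ t, ∑ i, s i * dirDeriv (v j) t (q i).1 = 0) :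
    s = 0 := by
  by_contra hne
  let D : (Fin n → ℝ) →ₗ[ℝ] (Fin m → ℝ) := LinearMap.pi fun i => differential (v j) (q i).1
  have hD : ∀ t i, D t i = dirDeriv (v j) t (q i).1 := fun _ _ => rfl
  have hrange : finrank ℝ (LinearMap.range D) < m := by
    have : LinearMap.range D < ⊤ := by
      refine lt_top_iff_ne_top.mpr fun h => hne ?_
      obtain ⟨t, ht⟩ := LinearMap.range_eq_top.mp h s
      have h1 := hs t
      simp only [← hD, ht] at h1
      funext i
      exact mul_self_eq_zero.mp
        ((Finset.sum_eq_zero_iff_of_nonneg fun i _ => mul_self_nonneg _).mp h1 i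
            (Finset.mem_univ i))
    simpa using Submodule.finrank_lt_finrank_of_lt this
  -- As m = n - 1, a rank drop makes the common tangent space at least two-dimensional, so it
  -- contains a direction t other than the point itself.
  have hker : 1 < finrank ℝ (LinearMap.ker D) := by
    have := LinearMap.finrank_range_add_finrank_ker D
    simp only [finrank_fintype_fun_eq_card, Fintype.card_fin] at this
    omega
  obtain ⟨t, htD, ht⟩ : ∃ t, D t = 0 ∧ ∀ c : ℝ, t ≠ c • v j := by
    by_contra! H
    have : LinearMap.ker D ≤ Submodule.span ℝ {v j} := fun t ht => by
      obtain ⟨c, hc⟩ := H t ht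
      exact Submodule.mem_span_singleton.mpr ⟨c, hc.symm⟩
    have h1 := Submodule.finrank_mono this
    have h2 := finrank_span_singleton (K := ℝ) (C.distinct.1 j)
    omega
  obtain ⟨k, hk⟩ := exists_ne j
  obtain ⟨u, hu⟩ := C.exists_relation
  obtain ⟨f, hfj, -, hf⟩ := C.exists_evalAt_two hu hk.symm
  obtain ⟨a, haj, hat⟩ := exists_linear_separating ht
  obtain ⟨b, hbk, hbj⟩ := exists_linear_separating (x := v k) (y := v j)
    fun c hc => hk.symm (C.distinct.2 _ _ c hc)
  let bp : Form n (d - 1) := ⟨b.1 ^ (d - 1), by simpa using IsHomogeneous.pow b.2 (d - 1)⟩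
  have hbp : ∀ x, evalAt (d - 1) x bp = evalAt 1 x b ^ (d - 1) := fun x => by
    simp [evalAt_apply, bp]
  -- The product f g vanishes at every point: f handles all but j and k, a handles j, and the power
  -- of b handles k because d - 1 > 0. Its derivative at v_j along t is f(v_j) b(v_j)^(d-1) a(t) ≠
  -- 0, while members of the ideal have derivative 0 along t.
  let g : Form n d := mul (by omega) a bp
  obtain ⟨h, hh⟩ := C.noether (mul (two_mul d).symm f g) fun i => by
    rw [evalAt_mul, evalAt_mul, hbp]
    by_cases hij : i = j
    · rw [hij, haj]; ring
    by_cases hik : i = k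
    · rw [hik, hbk, zero_pow (by omega)]; ring
    · rw [hf i hij hik]; ring
  have h1 := congrArg (fun F : Form n (2 * d) => dirDeriv (v j) t F.1) hh
  simp only [Submodule.coe_sum, map_sum, coe_mul, dirDeriv_mul] at h1
  rw [Finset.sum_eq_zero] at h1
  · have e1 : aeval (v j) a.1 = 0 := haj
    have e2 : aeval (v j) bp.1 = evalAt 1 (v j) b ^ (d - 1) := hbp _
    have e3 : aeval (v j) f.1 = u k := hfj
    simp only [g, coe_mul, dirDeriv_mul, map_mul, e1, e2, e3, dirDeriv_linear] at h1
    have := C.relation_ne_zero hu k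
    simp [this, hbj, hat] at h1
  · intro i _
    have e1 : aeval (v j) (q i).1 = 0 := C.vanish i j
    have e2 : dirDeriv (v j) t (q i).1 = 0 := congrFun htD i
    simp [e1, e2]

/-- The forms through all points but the last two are generated by the `q i` and one more form. -/
theorem mem_span_cons (C : IsCayleyBacharachConfig d K v q) {u : Fin (K + 2) → ℝ}
    (hu : IsCayleyBacharach d v u) {e : Form n d}
    (he1 : evalAt d (v (Fin.natAdd K 0)) e = u (Fin.natAdd K 1))
    (he2 : evalAt d (v (Fin.natAdd K 1)) e = -u (Fin.natAdd K 0))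
    (he : ∀ i : Fin K, evalAt d (v (Fin.castAdd 2 i)) e = 0)
    {g : Form n d} (hg : ∀ i : Fin K, evalAt d (v (Fin.castAdd 2 i)) g = 0) :
    g ∈ Submodule.span ℝ (Set.range (Fin.cons e q : Fin (m + 1) → Form n d)) := by
  have hrel := hu.2 g
  rw [Fin.sum_univ_add, Finset.sum_eq_zero (fun i _ => by rw [hg, mul_zero]), Fin.sum_univ_two]
    at hrel
  have hu2 := C.relation_ne_zero hu (Fin.natAdd K 1)
  set c := evalAt d (v (Fin.natAdd K 0)) g / u (Fin.natAdd K 1)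
  have hmem : g - c • e ∈ Submodule.span ℝ (Set.range q) := by
    refine C.span _ fun j => ?_
    refine Fin.addCases (fun i => by simp [hg, he]) (fun i => ?_) j
    rw [map_sub, map_smul, smul_eq_mul]
    fin_cases i
    · change evalAt d (v (Fin.natAdd K 0)) g - c * evalAt d (v (Fin.natAdd K 0)) e = 0
      rw [he1, div_mul_cancel₀ _ hu2, sub_self]
    · change evalAt d (v (Fin.natAdd K 1)) g - c * evalAt d (v (Fin.natAdd K 1)) e = 0
      rw [he2]
      simp only [c]
      field_simp
      linarith
  rw [Fin.range_cons, Set.insert_eq, Submodule.span_union]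
  rw [← sub_add_cancel g (c • e), add_comm]
  exact Submodule.add_mem_sup (Submodule.smul_mem _ _ (Submodule.mem_span_singleton_self e)) hmem

theorem exists_extra (C : IsCayleyBacharachConfig d K v q) {u : Fin (K + 2) → ℝ}
    (hu : IsCayleyBacharach d v u) : ∃ e : Form n d,
    evalAt d (v (Fin.natAdd K 0)) e = u (Fin.natAdd K 1) ∧
    evalAt d (v (Fin.natAdd K 1)) e = -u (Fin.natAdd K 0) ∧
    ∀ i : Fin K, evalAt d (v (Fin.castAdd 2 i)) e = 0 := by
  have h01 : (Fin.natAdd K 0 : Fin (K + 2)) ≠ Fin.natAdd K 1 := by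
    rw [Ne, Fin.natAdd_inj]; decide
  obtain ⟨e, h1, h2, h3⟩ := C.exists_evalAt_two hu h01
  refine ⟨e, h1, h2, fun i => h3 _ ?_ ?_⟩ <;>
  · intro h
    have := congrArg Fin.val h
    have := i.2
    simp at *
    omega

theorem mul_mem_productSpan {N : ℕ} {w : Fin N → Fin n → ℝ} {f g : Form n d}
    (hf : ∀ j, evalAt d (w j) f = 0) (hg : ∀ j, evalAt d (w j) g = 0) :
    mul (two_mul d).symm f g ∈ productSpan d w :=
  Submodule.subset_span ⟨f, g, hf, hg, rfl⟩

/-- The products of forms through all points but the last two, inside the forms singular at these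
points. -/
theorem mem_productSpan_iff (C : IsCayleyBacharachConfig d K v q) (hm : m + 1 = n) (hd : 2 ≤ d)
    {u : Fin (K + 2) → ℝ} (hu : IsCayleyBacharach d v u) {p : Form n (2 * d)}
    (hp : p ∈ singularForms (2 * d) fun j : Fin K => v (Fin.castAdd 2 j)) :
    p ∈ productSpan d (fun j : Fin K => v (Fin.castAdd 2 j)) ↔
      u (Fin.natAdd K 0) ^ 2 * evalAt (2 * d) (v (Fin.natAdd K 0)) p =
        u (Fin.natAdd K 1) ^ 2 * evalAt (2 * d) (v (Fin.natAdd K 1)) p := by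
  constructor
  · intro h
    clear hp
    induction h using Submodule.span_induction with
    | mem f hf =>
      obtain ⟨g, h, hg, hh, hf⟩ := hf
      obtain rfl : f = mul (two_mul d).symm g h := Subtype.ext hf
      have hrel : ∀ g : Form n d, (∀ i : Fin K, evalAt d (v (Fin.castAdd 2 i)) g = 0) →
          u (Fin.natAdd K 0) * evalAt d (v (Fin.natAdd K 0)) g =
            -(u (Fin.natAdd K 1) * evalAt d (v (Fin.natAdd K 1)) g) := fun g hg => by
        have := hu.2 g
        rw [Fin.sum_univ_add, Finset.sum_eq_zero (fun i _ => by rw [hg, mul_zero]),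
          Fin.sum_univ_two] at this
        linarith
      have h1 := congrArg₂ (· * ·) (hrel g hg) (hrel h hh)
      simp only [evalAt_mul] at h1 ⊢
      linarith
    | zero => simp
    | add f g _ _ h1 h2 => simp only [map_add, mul_add, h1, h2]
    | smul c f _ h1 => simp only [map_smul, smul_eq_mul, mul_left_comm _ c, h1]
  · intro heq
    obtain ⟨e, he1, he2, he⟩ := C.exists_extra hu
    have hu1 := C.relation_ne_zero hu (Fin.natAdd K 0)
    have hu2 := C.relation_ne_zero hu (Fin.natAdd K 1)
    -- Chosen so that p - c e² vanishes at the first extra point; the assumed equality makes it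
    -- vanish at the second one too.
    set c := evalAt (2 * d) (v (Fin.natAdd K 0)) p / u (Fin.natAdd K 1) ^ 2
    have hemem := mul_mem_productSpan he he
    suffices h : p - c • mul (two_mul d).symm e e ∈
        productSpan d (fun j : Fin K => v (Fin.castAdd 2 j)) by
      have := add_mem h (Submodule.smul_mem _ c hemem)
      rwa [sub_add_cancel] at this
    obtain ⟨f, hf⟩ := C.noether (p - c • mul (two_mul d).symm e e) fun j => by
      refine Fin.addCases (fun i => ?_) (fun i => ?_) j
      · simp [he, evalAt_eq_zero_of_mem_singularForms (by omega) hp i]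
      · rw [map_sub, map_smul, smul_eq_mul, evalAt_mul]
        fin_cases i
        · change evalAt (2 * d) (v (Fin.natAdd K 0)) p - c * (evalAt d (v (Fin.natAdd K 0)) e *
            evalAt d (v (Fin.natAdd K 0)) e) = 0
          rw [he1]
          simp only [c]
          field_simp
          simp
        · change evalAt (2 * d) (v (Fin.natAdd K 1)) p - c * (evalAt d (v (Fin.natAdd K 1)) e *
            evalAt d (v (Fin.natAdd K 1)) e) = 0
          rw [he2]
          simp only [c]
          field_simp
          linarith
    -- Differentiating ∑ f_i q_i at a singular point of p gives ∑ f_i(v_j) dq_i = 0, and the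
    -- differentials dq_i are independent there.
    have hfv : ∀ j : Fin K, ∀ i, evalAt d (v (Fin.castAdd 2 j)) (f i) = 0 := by
      intro j
      refine congrFun (C.transverse hm hd (Fin.castAdd 2 j) _ fun t => ?_)
      have h1 := congrArg (fun F : Form n (2 * d) => dirDeriv (v (Fin.castAdd 2 j)) t F.1) hf
      have h2 : dirDeriv (v (Fin.castAdd 2 j)) t (e.1 * e.1) = 0 :=
        dirDeriv_eq_zero_of_aeval _ _ (he j) (he j)
      simp only [Submodule.coe_sum, Submodule.coe_sub, Submodule.coe_smul, map_sub, map_smul,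
        map_sum, coe_mul, h2, mem_singularForms.mp hp j t, smul_zero, sub_zero] at h1
      rw [h1]
      refine Finset.sum_congr rfl fun i _ => ?_
      have h3 : aeval (v (Fin.castAdd 2 j)) (q i).1 = 0 := C.vanish i _
      rw [dirDeriv_mul, h3, zero_mul, add_zero]
      rfl
    rw [hf]
    exact Submodule.sum_mem _ fun i _ => mul_mem_productSpan (fun j => hfv j i)
      fun j => C.vanish i _

theorem productSpan_le (w : Fin K → Fin n → ℝ) :
    productSpan d w ≤ singularForms (2 * d) w := by
  refine Submodule.span_le.mpr ?_
  rintro f ⟨g, h, hg, hh, hf⟩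
  refine mem_singularForms.mpr fun j t => ?_
  rw [hf]
  exact dirDeriv_eq_zero_of_aeval _ _ (hg j) (hh j)

/-- The forms through the first K points are spanned by m + 1 forms, so their products span at most
`(m + 2).choose 2` dimensions, whereas singularity imposes at most K * n conditions. In the two
applications this reads 6 < 28 - 21 and 10 < 35 - 24. -/
theorem productSpan_lt (C : IsCayleyBacharachConfig d K v q) 
    (hdim : (m + 2).choose 2 + K * n < finrank ℝ (Form n (2 * d))) :
    productSpan d (fun j : Fin K => v (Fin.castAdd 2 j)) <
      singularForms (2 * d) (fun j : Fin K => v (Fin.castAdd 2 j)) := by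
  refine lt_of_le_of_ne (productSpan_le _) fun heq => ?_
  obtain ⟨u, hu⟩ := C.exists_relation
  obtain ⟨e, he1, he2, he⟩ := C.exists_extra hu
  let G : Fin (m + 1) → Form n d := Fin.cons e q
  -- Unordered pairs, so that each product of two generators is counted once.
  let P : Sym2 (Fin (m + 1)) → Form n (2 * d) := Sym2.lift
    ⟨fun i j => mul (two_mul d).symm (G i) (G j), fun i j => Subtype.ext (mul_comm _ _)⟩
  have hle : productSpan d (fun j : Fin K => v (Fin.castAdd 2 j)) ≤
      Submodule.span ℝ (Set.range P) := by
    refine Submodule.span_le.mpr ?_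
    rintro f ⟨g, h, hg, hh, hf⟩
    obtain rfl : f = mul (two_mul d).symm g h := Subtype.ext hf
    obtain ⟨α, rfl⟩ := (Submodule.mem_span_range_iff_exists_fun ℝ).mp
      (C.mem_span_cons hu he1 he2 he hg)
    obtain ⟨β, rfl⟩ := (Submodule.mem_span_range_iff_exists_fun ℝ).mp
      (C.mem_span_cons hu he1 he2 he hh)
    simp only [map_sum, LinearMap.sum_apply, map_smul, LinearMap.smul_apply]
    exact Submodule.sum_mem _ fun i _ => Submodule.smul_mem _ _ <| Submodule.sum_mem _ fun j _ =>
      Submodule.smul_mem _ _ <| Submodule.subset_span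
        (show mul (two_mul d).symm (G j) (G i) ∈ Set.range P from ⟨s(j, i), rfl⟩)
  have h1 := Submodule.finrank_mono hle
  have h2 : finrank ℝ (Submodule.span ℝ (Set.range P)) ≤ _ := finrank_range_le_card P
  rw [Sym2.card, Fintype.card_fin] at h2
  have h3 := finrank_le_singularForms (2 * d) K (fun j : Fin K => v (Fin.castAdd 2 j))
  rw [← heq] at h3
  rw [show m + 1 + 1 = m + 2 from rfl] at h2
  omega

/-- The theorem for all configurations of this kind. -/
theorem main (C : IsCayleyBacharachConfig d K v q) (hm : m + 1 = n) (hd : 2 ≤ d) (hK : 1 ≤ K)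
    (hdim : (m + 2).choose 2 + K * n < finrank ℝ (Form n (2 * d)))
    {p : Form n (2 * d)} (hp : p ∈ frontier (psdCone n (2 * d)))
    (hzero : HasZeroSet p (fun j : Fin K => v (Fin.castAdd 2 j))) :
    (∃ u : Fin (K + 2) → ℝ, IsCayleyBacharach d v u ∧ (∀ j, u j ≠ 0) ∧
      ∀ u' : Fin (K + 2) → ℝ, IsCayleyBacharach d v u' → ∃ c : ℝ, u' = c • u) ∧
    (∀ u : Fin (K + 2) → ℝ, IsCayleyBacharach d v u →
      (u (Fin.natAdd K 0) ^ 2 * evalAt (2 * d) (v (Fin.natAdd K 0)) p ≠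
          u (Fin.natAdd K 1) ^ 2 * evalAt (2 * d) (v (Fin.natAdd K 1)) p →
        ∃ a : Fin (K + 2) → ℝ, pointFunctional (2 * d) v a ∈ sosDual n d ∧
          pointFunctional (2 * d) v a p < 0 ∧
          SpansExtremeRay (sosDual n d) (pointFunctional (2 * d) v a)) ∧
      (u (Fin.natAdd K 0) ^ 2 * evalAt (2 * d) (v (Fin.natAdd K 0)) p =
          u (Fin.natAdd K 1) ^ 2 * evalAt (2 * d) (v (Fin.natAdd K 1)) p ↔
        p ∈ productSpan d (fun j : Fin K => v (Fin.castAdd 2 j)))) ∧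
    productSpan d (fun j : Fin K => v (Fin.castAdd 2 j)) <
      singularForms (2 * d) (fun j : Fin K => v (Fin.castAdd 2 j)) := by
  have hnonneg := nonneg_of_mem_frontier hp
  have h0 : ∀ j : Fin K, evalAt (2 * d) (v (Fin.castAdd 2 j)) p = 0 := fun j =>
    (hzero _ (C.distinct.1 _)).mpr ⟨j, 1, (one_smul _ _).symm⟩
  have hpos : ∀ i : Fin 2, 0 < evalAt (2 * d) (v (Fin.natAdd K i)) p := fun i => by
    refine lt_of_le_of_ne (hnonneg _) fun h => ?_
    obtain ⟨j, c, hc⟩ := (hzero _ (C.distinct.1 _)).mp h.symm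
    have := congrArg Fin.val (C.distinct.2 _ _ c hc)
    have := j.2
    simp at *
    omega
  have hrest : ∀ j : Fin (K + 2), j ≠ Fin.natAdd K 0 → j ≠ Fin.natAdd K 1 →
      evalAt (2 * d) (v j) p = 0 := fun j => by
    refine Fin.addCases (fun i _ _ => h0 i) (fun i h1 h2 => ?_) j
    fin_cases i
    · exact absurd rfl h1
    · exact absurd rfl h2
  have h01 : (Fin.natAdd K 0 : Fin (K + 2)) ≠ Fin.natAdd K 1 := by
    rw [Ne, Fin.natAdd_inj]; decide
  refine ⟨?_, fun u hu => ⟨fun hne => ?_, ?_⟩, C.productSpan_lt hdim⟩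
  · obtain ⟨u, hu⟩ := C.exists_relation
    exact ⟨u, hu, C.relation_ne_zero hu, fun u' hu' => C.exists_smul_eq hu hu'.2⟩
  · rcases lt_or_gt_of_ne hne with h | h
    · exact C.exists_certificate_of_lt hK hu h01.symm (fun j h1 h2 => hrest j h2 h1) (hpos 0) h
    · exact C.exists_certificate_of_lt hK hu h01 hrest (hpos 1) h
  · exact (C.mem_productSpan_iff hm hd hu (mem_singularForms.mpr fun j t =>
      dirDeriv_eq_zero_of_nonneg hnonneg (h0 j) t)).symm

end IsCayleyBacharachConfig

end Form

/-! ### Points that impose independent conditions. -/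

namespace Form

open MvPolynomial Module

variable {n : ℕ}

theorem DistinctProjectively.comp {N M : ℕ} {v : Fin N → Fin n → ℝ} (h : DistinctProjectively v)
    {τ : Fin M → Fin N} (hτ : Function.Injective τ) : DistinctProjectively fun i => v (τ i) :=
  ⟨fun _ => h.1 _, fun _ _ c hc => hτ (h.2 _ _ c hc)⟩

theorem NoneOnHypersurface.comp {N M k d : ℕ} {v : Fin N → Fin n → ℝ}
    (h : NoneOnHypersurface k d v) {τ : Fin M → Fin N} (hτ : Function.Injective τ) :
    NoneOnHypersurface k d fun i => v (τ i) := fun S hS f hf =>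
  h (S.map ⟨τ, hτ⟩) (by simpa using hS) f (by simpa using hf)

/-- Relations that miss a point are trivial if every relation between all points but one has
vanishing first coefficient, for every numbering of the points. -/
theorem eq_zero_of_relation {N d : ℕ} {v : Fin (N + 2) → Fin n → ℝ}
    (H : ∀ τ : Fin (N + 1) → Fin (N + 2), Function.Injective τ → ∀ w : Fin (N + 1) → ℝ,
      (∀ f : Form n d, ∑ i, w i * evalAt d (v (τ i)) f = 0) → w 0 = 0)
    (w : Fin (N + 2) → ℝ) (hw : ∀ f : Form n d, ∑ j, w j * evalAt d (v j) f = 0)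
    (z : Fin (N + 2)) (hz : w z = 0) : w = 0 := by
  funext e
  by_cases hez : e = z
  · rw [hez, hz]; rfl
  obtain ⟨i, hi⟩ := Fin.exists_succAbove_eq hez
  -- All points but z, renumbered so that e comes first.
  have := H (fun k => z.succAbove (Equiv.swap 0 i k))
    (Fin.succAbove_right_injective.comp (Equiv.injective _))
    (fun k => w (z.succAbove (Equiv.swap 0 i k))) fun f => by
      rw [Equiv.sum_comp (Equiv.swap 0 i)
        fun k => w (z.succAbove k) * evalAt d (v (z.succAbove k)) f]
      have := hw f
      rwa [Fin.sum_univ_succAbove _ z, hz, zero_mul, zero_add] at this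
  simpa [hi] using this

theorem exists_form_vanishing {ι : Type*} [Fintype ι] {d : ℕ} (v : ι → Fin n → ℝ)
    (h : Fintype.card ι < finrank ℝ (Form n d)) :
    ∃ f : Form n d, f ≠ 0 ∧ ∀ i, evalAt d (v i) f = 0 := by
  have := LinearMap.ker_ne_bot_of_finrank_lt (f := LinearMap.pi fun j => evalAt d (v j))
    (by simpa using h)
  obtain ⟨f, hf, hne⟩ := Submodule.exists_mem_ne_zero_of_ne_bot this
  exact ⟨f, hne, fun i => congrFun hf i⟩

/-- Two nonzero forms through one point less than the dimension are proportional if the points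
impose independent conditions. -/
theorem exists_eq_smul {N d : ℕ} (v : Fin N → Fin n → ℝ)
    (h : ∀ w : Fin N → ℝ, (∀ f : Form n d, ∑ j, w j * evalAt d (v j) f = 0) → w = 0)
    (hN : finrank ℝ (Form n d) = N + 1) {f g : Form n d} (hf : f ≠ 0)
    (hfv : ∀ j, evalAt d (v j) f = 0) (hgv : ∀ j, evalAt d (v j) g = 0) : ∃ c : ℝ, g = c • f := by
  have h1 := finrank_vanishing v h
  rw [hN, Fintype.card_fin] at h1
  have h2 : finrank ℝ (LinearMap.ker (LinearMap.pi fun j => evalAt d (v j))) = 1 := by omega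
  obtain ⟨c, hc⟩ := (finrank_eq_one_iff_of_nonzero'
    (⟨f, funext hfv⟩ : LinearMap.ker (LinearMap.pi fun j => evalAt d (v j)))
    (fun h => hf (congrArg Subtype.val h))).mp h2 ⟨g, funext hgv⟩
  exact ⟨c, (congrArg Subtype.val hc).symm⟩

theorem sum_smul_eq_zero {ι : Type*} [Fintype ι] {v : ι → Fin n → ℝ} {w : ι → ℝ}
    (h : ∀ f : Form n 1, ∑ j, w j * evalAt 1 (v j) f = 0) : ∑ j, w j • v j = 0 := by
  ext i
  simpa using h (ofDual (LinearMap.proj i))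

theorem DistinctProjectively.pair {N : ℕ} {v : Fin N → Fin n → ℝ} (h : DistinctProjectively v)
    {i j : Fin N} (hij : i ≠ j) {a b : ℝ} (hab : a • v i + b • v j = 0) : a = 0 ∧ b = 0 := by
  have ha : a = 0 := by
    by_contra ha
    refine hij (h.2 i j (-(a⁻¹ * b)) ?_)
    have := congrArg (a⁻¹ • ·) hab
    simp only [smul_add, smul_smul, inv_mul_cancel₀ ha, one_smul, smul_zero] at this
    rw [neg_smul]
    exact eq_neg_of_add_eq_zero_left this
  refine ⟨ha, ?_⟩
  rw [ha, zero_smul, zero_add] at hab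
  exact (smul_eq_zero.mp hab).resolve_right (h.1 j)

/-! ### Relations on conics and cubics in the plane. -/

section Plane

/-- Two lines in the plane with two common points agree. -/
theorem four_on_line {N : ℕ} {x : Fin N → Fin 3 → ℝ} (hx : DistinctProjectively x)
    (hl : NoneOnHypersurface 4 1 x) {i a b c : Fin N}
        (hS : ({i, a, b, c} : Finset (Fin N)).card = 4)
    (hia : i ≠ a) {f g : Form 3 1} (hf : f ≠ 0) (hg : g ≠ 0)
    (hfi : evalAt 1 (x i) f = 0) (hfa : evalAt 1 (x a) f = 0) (hfb : evalAt 1 (x b) f = 0)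
    (hgi : evalAt 1 (x i) g = 0) (hga : evalAt 1 (x a) g = 0) (hgc : evalAt 1 (x c) g = 0) :
    False := by
  obtain ⟨s, rfl⟩ := exists_eq_smul (d := 1) ![x i, x a] (fun w hw => by
      have h := sum_smul_eq_zero hw
      rw [Fin.sum_univ_two] at h
      obtain ⟨h0, h1⟩ := hx.pair hia h
      funext k; fin_cases k <;> assumption)
    (by rw [finrank_eq]; rfl) hf
    (fun j => by fin_cases j <;> assumption) (fun j => by fin_cases j <;> assumption)
  have hs : s ≠ 0 := by rintro rfl; simp at hg
  refine hf (hl _ hS f fun j hj => ?_)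
  simp only [Finset.mem_insert, Finset.mem_singleton] at hj
  rcases hj with rfl | rfl | rfl | rfl
  · exact hfi
  · exact hfa
  · exact hfb
  · simpa [hs] using hgc

/-- A pair of lines covering the other four points leaves only the term at `x 0`, so if its
coefficient is nonzero, one of the lines passes through `x 0`. Two different pairings give lines
sharing `x 0` and another point, hence one line with four points. -/
theorem conic_relation_head {x : Fin 5 → Fin 3 → ℝ} (hx : DistinctProjectively x)
    (hl : NoneOnHypersurface 4 1 x) {w : Fin 5 → ℝ}
    (hw : ∀ f : Form 3 2, ∑ j, w j * evalAt 2 (x j) f = 0) : w 0 = 0 := by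
  by_contra hw0
  have key : ∀ a b c d : Fin 5, (∀ t, t = 0 ∨ t = a ∨ t = b ∨ t = c ∨ t = d) →
      (∃ f : Form 3 1, f ≠ 0 ∧ evalAt 1 (x 0) f = 0 ∧ evalAt 1 (x a) f = 0 ∧
        evalAt 1 (x b) f = 0) ∨
      (∃ f : Form 3 1, f ≠ 0 ∧ evalAt 1 (x 0) f = 0 ∧ evalAt 1 (x c) f = 0 ∧
        evalAt 1 (x d) f = 0) := by
    intro a b c d hcov
    obtain ⟨f, hf, hfv⟩ := exists_form_vanishing (d := 1) ![x a, x b] (by rw [finrank_eq]; decide)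
    obtain ⟨g, hg, hgv⟩ := exists_form_vanishing (d := 1) ![x c, x d] (by rw [finrank_eq]; decide)
    have hfa : evalAt 1 (x a) f = 0 := hfv 0
    have hfb : evalAt 1 (x b) f = 0 := hfv 1
    have hgc : evalAt 1 (x c) g = 0 := hgv 0
    have hgd : evalAt 1 (x d) g = 0 := hgv 1
    have h := hw (mul rfl f g)
    rw [Finset.sum_eq_single 0] at h
    · simp only [evalAt_mul, mul_eq_zero, hw0, false_or] at h
      rcases h with h | h
      · exact Or.inl ⟨f, hf, h, hfa, hfb⟩
      · exact Or.inr ⟨g, hg, h, hgc, hgd⟩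
    · intro t _ ht
      rcases hcov t with rfl | rfl | rfl | rfl | rfl
      · exact absurd rfl ht
      all_goals simp [*]
    · simp
  rcases key 1 2 3 4 (by decide) with ⟨f, hf, hf0, hf1, hf2⟩ | ⟨f, hf, hf0, hf1, hf2⟩ <;>
  rcases key 1 3 2 4 (by decide) with ⟨g, hg, hg0, hg1, hg2⟩ | ⟨g, hg, hg0, hg1, hg2⟩
  · exact four_on_line hx hl (i := 0) (a := 1) (by decide) (by decide) hf hg hf0 hf1 hf2 hg0 hg1 hg2
  · exact four_on_line hx hl (i := 0) (a := 2) (by decide) (by decide) hf hg hf0 hf2 hf1 hg0 hg1 hg2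
  · exact four_on_line hx hl (i := 0) (a := 3) (by decide) (by decide) hf hg hf0 hf1 hf2 hg0 hg2 hg1
  · exact four_on_line hx hl (i := 0) (a := 4) (by decide) (by decide) hf hg hf0 hf2 hf1 hg0 hg2 hg1

/-- Five points in the plane, no four on a line, impose independent conditions on conics. -/
theorem conic_relation_eq_zero {x : Fin 5 → Fin 3 → ℝ} (hx : DistinctProjectively x)
    (hl : NoneOnHypersurface 4 1 x) {w : Fin 5 → ℝ}
    (hw : ∀ f : Form 3 2, ∑ j, w j * evalAt 2 (x j) f = 0) : w = 0 := by
  funext i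
  have hinj := (Equiv.swap 0 i).injective
  have := conic_relation_head (hx.comp hinj) (hl.comp hinj) (w := fun k => w (Equiv.swap 0 i k))
    fun f => by
      rw [Equiv.sum_comp (Equiv.swap 0 i) fun k => w k * evalAt 2 (x k) f]
      exact hw f
  simpa using this

/-- Test cubics are a line through `x 1`, `x b` times a conic through the other five points besides
`x 0`. If the first coefficient is nonzero, either the line or the conic contains `x 0`. Among b =
2, 3, 4 the line can do so only once, since otherwise four points are collinear; the two remaining
conics share five points, coincide, and contain seven points. -/
theorem cubic_relation_head {x : Fin 8 → Fin 3 → ℝ} (hx : DistinctProjectively x)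
    (hl : NoneOnHypersurface 4 1 x) (hc : NoneOnHypersurface 7 2 x) {w : Fin 8 → ℝ}
    (hw : ∀ f : Form 3 3, ∑ j, w j * evalAt 3 (x j) f = 0) : w 0 = 0 := by
  by_contra hw0
  have hcard : ∀ b : Fin 8, b ≠ 0 → b ≠ 1 →
      Fintype.card {t : Fin 8 // t ≠ 0 ∧ t ≠ 1 ∧ t ≠ b} < 6 := by decide
  have key : ∀ b : Fin 8, b ≠ 0 → b ≠ 1 →
      (∃ f : Form 3 1, f ≠ 0 ∧ evalAt 1 (x 0) f = 0 ∧ evalAt 1 (x 1) f = 0 ∧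
        evalAt 1 (x b) f = 0) ∨
      (∃ f : Form 3 2, f ≠ 0 ∧ ∀ t, t ≠ 1 → t ≠ b → evalAt 2 (x t) f = 0) := by
    intro b hb0 hb1
    obtain ⟨f, hf, hfv⟩ := exists_form_vanishing (d := 1) ![x 1, x b] (by rw [finrank_eq]; decide)
    obtain ⟨g, hg, hgv⟩ := exists_form_vanishing (d := 2)
      (fun t : {t : Fin 8 // t ≠ 0 ∧ t ≠ 1 ∧ t ≠ b} => x t.1)
      (by rw [finrank_eq]; exact hcard b hb0 hb1)
    have hfa : evalAt 1 (x 1) f = 0 := hfv 0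
    have hfb : evalAt 1 (x b) f = 0 := hfv 1
    have h := hw (mul rfl f g)
    rw [Finset.sum_eq_single 0] at h
    · simp only [evalAt_mul, mul_eq_zero, hw0, false_or] at h
      rcases h with h | h
      · exact Or.inl ⟨f, hf, h, hfa, hfb⟩
      · refine Or.inr ⟨g, hg, fun t h1 h2 => ?_⟩
        by_cases h0 : t = 0
        · rw [h0, h]
        · exact hgv ⟨t, h0, h1, h2⟩
    · intro t _ ht
      rw [evalAt_mul]
      by_cases h1 : t = 1
      · rw [h1, hfa]; ring
      by_cases h2 : t = b
      · rw [h2, hfb]; ring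
      · rw [hgv ⟨t, ht, h1, h2⟩]; ring
    · simp
  -- σ lists the five points common to the conics that omit 1, b and 1, c. The conics are
  -- proportional by independence, so the common one omits at most `x 1`.
  have hconic : ∀ b c : Fin 8, ∀ σ : Fin 5 → Fin 8, Function.Injective σ →
      (∀ i, σ i ≠ 1 ∧ σ i ≠ b ∧ σ i ≠ c) → b ≠ 1 → b ≠ c →
      (∃ f : Form 3 2, f ≠ 0 ∧ ∀ t, t ≠ 1 → t ≠ b → evalAt 2 (x t) f = 0) →
      (∃ f : Form 3 2, f ≠ 0 ∧ ∀ t, t ≠ 1 → t ≠ c → evalAt 2 (x t) f = 0) → False := by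
    rintro b c σ hσ hσ' hb1 hbc ⟨f, hf, hfv⟩ ⟨g, hg, hgv⟩
    obtain ⟨s, rfl⟩ := exists_eq_smul (fun i => x (σ i))
      (fun w hw => conic_relation_eq_zero (hx.comp hσ) (hl.comp hσ) hw)
      (by rw [finrank_eq]; rfl) hf (fun j => hfv _ (hσ' j).1 (hσ' j).2.1)
      (fun j => hgv _ (hσ' j).1 (hσ' j).2.2)
    have hs : s ≠ 0 := by rintro rfl; simp at hg
    refine hf (hc (Finset.univ.erase 1) (by decide) f fun t ht => ?_)
    have ht1 := Finset.ne_of_mem_erase ht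
    by_cases htb : t = b
    · subst htb
      simpa [hs] using hgv t ht1 hbc
    · exact hfv t ht1 htb
  rcases key 2 (by decide) (by decide) with ⟨f, hf, hf0, hf1, hf2⟩ | h2 <;>
  rcases key 3 (by decide) (by decide) with ⟨g, hg, hg0, hg1, hg2⟩ | h3
  · exact four_on_line hx hl (i := 0) (a := 1) (by decide) (by decide) hf hg hf0 hf1 hf2 hg0 hg1 hg2
  · rcases key 4 (by decide) (by decide) with ⟨g, hg, hg0, hg1, hg2⟩ | h4
    · exact four_on_line hx hl (i := 0) (a := 1) (by decide) (by decide) hf hg hf0 hf1 hf2 hg0 hg1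
        hg2
    · exact hconic 3 4 ![0, 2, 5, 6, 7] (by decide) (by decide) (by decide) (by decide) h3 h4
  · rcases key 4 (by decide) (by decide) with ⟨f, hf, hf0, hf1, hf2⟩ | h4
    · exact four_on_line hx hl (i := 0) (a := 1) (by decide) (by decide) hf hg hf0 hf1 hf2 hg0 hg1
        hg2
    · exact hconic 2 4 ![0, 3, 5, 6, 7] (by decide) (by decide) (by decide) (by decide) h2 h4
  · exact hconic 2 3 ![0, 4, 5, 6, 7] (by decide) (by decide) (by decide) (by decide) h2 h3

end Plane

/-! ### Relations on quadrics in space. -/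

section Space

/-- Two planes with three common points that are not collinear agree. -/
theorem five_on_plane {N : ℕ} {x : Fin N → Fin 4 → ℝ} (hx : DistinctProjectively x)
    (hp : NoneOnHypersurface 5 1 x) {i a b c d : Fin N}
    (hS : ({i, a, b, c, d} : Finset (Fin N)).card = 5) (hia : i ≠ a)
    (hcol : ∀ α β : ℝ, x b ≠ α • x i + β • x a)
    {f g : Form 4 1} (hf : f ≠ 0) (hg : g ≠ 0)
    (hfi : evalAt 1 (x i) f = 0) (hfa : evalAt 1 (x a) f = 0) (hfb : evalAt 1 (x b) f = 0)
    (hfc : evalAt 1 (x c) f = 0)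
    (hgi : evalAt 1 (x i) g = 0) (hga : evalAt 1 (x a) g = 0) (hgb : evalAt 1 (x b) g = 0)
    (hgd : evalAt 1 (x d) g = 0) : False := by
  obtain ⟨s, rfl⟩ := exists_eq_smul (d := 1) ![x i, x a, x b] (fun w hw => by
      have h := sum_smul_eq_zero hw
      rw [Fin.sum_univ_three] at h
      change w 0 • x i + w 1 • x a + w 2 • x b = 0 at h
      have h2 : w 2 = 0 := by
        by_contra h2
        refine hcol (-((w 2)⁻¹ * w 0)) (-((w 2)⁻¹ * w 1)) ?_
        have := congrArg ((w 2)⁻¹ • ·) h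
        simp only [smul_add, smul_smul, inv_mul_cancel₀ h2, one_smul, smul_zero] at this
        rw [neg_smul, neg_smul, ← neg_add]
        exact eq_neg_of_add_eq_zero_right this
      rw [h2, zero_smul, add_zero] at h
      obtain ⟨h0, h1⟩ := hx.pair hia h
      funext k; fin_cases k <;> assumption)
    (by rw [finrank_eq]; rfl) hf
    (fun j => by fin_cases j <;> assumption) (fun j => by fin_cases j <;> assumption)
  have hs : s ≠ 0 := by rintro rfl; simp at hg
  refine hf (hp _ hS f fun j hj => ?_)
  simp only [Finset.mem_insert, Finset.mem_singleton] at hj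
  rcases hj with rfl | rfl | rfl | rfl | rfl
  · exact hfi
  · exact hfa
  · exact hfb
  · exact hfc
  · simpa [hs] using hgd

/-- The points `x 0`, `x a`, `x b`, `x c` are coplanar. -/
def CoplanarWithHead (x : Fin 7 → Fin 4 → ℝ) (a b c : Fin 7) : Prop :=
  ∃ f : Form 4 1, f ≠ 0 ∧ evalAt 1 (x 0) f = 0 ∧ evalAt 1 (x a) f = 0 ∧ evalAt 1 (x b) f = 0 ∧
    evalAt 1 (x c) f = 0

/-- The product of planes through the two triples kills every term of the relation except the one at
`x 0`. -/
theorem coplanar_or_coplanar {x : Fin 7 → Fin 4 → ℝ} {w : Fin 7 → ℝ}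
    (hw : ∀ f : Form 4 2, ∑ j, w j * evalAt 2 (x j) f = 0) (hw0 : w 0 ≠ 0) {a b c d e g : Fin 7}
    (hcov : ∀ t, t = 0 ∨ t = a ∨ t = b ∨ t = c ∨ t = d ∨ t = e ∨ t = g) :
    CoplanarWithHead x a b c ∨ CoplanarWithHead x d e g := by
  obtain ⟨f, hf, hfv⟩ := exists_form_vanishing (d := 1) ![x a, x b, x c]
    (by rw [finrank_eq]; decide)
  obtain ⟨k, hk, hkv⟩ := exists_form_vanishing (d := 1) ![x d, x e, x g]
    (by rw [finrank_eq]; decide)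
  have hfa : evalAt 1 (x a) f = 0 := hfv 0
  have hfb : evalAt 1 (x b) f = 0 := hfv 1
  have hfc : evalAt 1 (x c) f = 0 := hfv 2
  have hkd : evalAt 1 (x d) k = 0 := hkv 0
  have hke : evalAt 1 (x e) k = 0 := hkv 1
  have hkg : evalAt 1 (x g) k = 0 := hkv 2
  have h := hw (mul rfl f k)
  rw [Finset.sum_eq_single 0] at h
  · simp only [evalAt_mul, mul_eq_zero, hw0, false_or] at h
    rcases h with h | h
    · exact Or.inl ⟨f, hf, h, hfa, hfb, hfc⟩
    · exact Or.inr ⟨k, hk, h, hkd, hke, hkg⟩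
  · intro t _ ht
    rcases hcov t with rfl | rfl | rfl | rfl | rfl | rfl | rfl
    · exact absurd rfl ht
    all_goals simp [*]
  · simp

/-- Split the six other points so that a and b lie in different triples. Whichever triple is
coplanar with `x 0`, its plane contains the line through `x 0`, `x a`, `x b`, hence five points. -/
theorem not_collinear {x : Fin 7 → Fin 4 → ℝ} (hx : DistinctProjectively x)
    (hp : NoneOnHypersurface 5 1 x) {w : Fin 7 → ℝ}
    (hw : ∀ f : Form 4 2, ∑ j, w j * evalAt 2 (x j) f = 0) (hw0 : w 0 ≠ 0) {a b c d e g : Fin 7}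
    (hcov : ∀ t, t = 0 ∨ t = a ∨ t = c ∨ t = d ∨ t = b ∨ t = e ∨ t = g)
    (h1 : ({0, a, b, c, d} : Finset (Fin 7)).card = 5)
    (h2 : ({0, a, b, e, g} : Finset (Fin 7)).card = 5) (hb : b ≠ 0) (α β : ℝ) :
    x b ≠ α • x 0 + β • x a := by
  intro hcol
  have hβ : β ≠ 0 := by
    rintro rfl
    refine hb (hx.2 b 0 α ?_)
    rw [hcol, zero_smul, add_zero]
  have hev : ∀ f : Form 4 1, evalAt 1 (x 0) f = 0 →
      evalAt 1 (x b) f = β * evalAt 1 (x a) f := fun f hf => by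
    rw [hcol, evalAt_linear_combination, hf]; ring
  rcases coplanar_or_coplanar hw hw0 hcov with ⟨f, hf, hf0, hfa, hfc, hfd⟩
      | ⟨f, hf, hf0, hfb, hfc, hfd⟩
  · have hfb : evalAt 1 (x b) f = 0 := by rw [hev f hf0, hfa, mul_zero]
    refine hf (hp _ h1 f fun j hj => ?_)
    simp only [Finset.mem_insert, Finset.mem_singleton] at hj
    rcases hj with rfl | rfl | rfl | rfl | rfl <;> assumption
  · have hfa : evalAt 1 (x a) f = 0 := by
      have := hev f hf0
      rw [hfb] at this
      simpa [hβ] using this.symm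
    refine hf (hp _ h2 f fun j hj => ?_)
    simp only [Finset.mem_insert, Finset.mem_singleton] at hj
    rcases hj with rfl | rfl | rfl | rfl | rfl <;> assumption

/-- If 0, 1, 2, 3 are coplanar, then 0, 1, 2, 4 and 0, 1, 2, 5 are not, since either would put five
points on a plane. The complementary triples then make 0, 3, 5, 6 and 0, 3, 4, 6 coplanar, and these
planes agree because 0, 3, 6 are not collinear. -/
theorem not_coplanar {x : Fin 7 → Fin 4 → ℝ} (hx : DistinctProjectively x)
    (hp : NoneOnHypersurface 5 1 x) {w : Fin 7 → ℝ}
    (hw : ∀ f : Form 4 2, ∑ j, w j * evalAt 2 (x j) f = 0) (hw0 : w 0 ≠ 0) :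
    ¬ CoplanarWithHead x 1 2 3 := by
  rintro ⟨f, hf, hf0, hf1, hf2, hf3⟩
  have h12 := not_collinear hx hp hw hw0 (a := 1) (b := 2) (c := 3) (d := 4) (e := 5) (g := 6)
    (by decide) (by decide) (by decide) (by decide)
  have h36 := not_collinear hx hp hw hw0 (a := 3) (b := 6) (c := 1) (d := 2) (e := 4) (g := 5)
    (by decide) (by decide) (by decide) (by decide)
  rcases coplanar_or_coplanar hw hw0 (a := 1) (b := 2) (c := 4) (d := 3) (e := 5) (g := 6)
    (by decide) with ⟨k, hk, hk0, hk1, hk2, hk3⟩ | ⟨k, hk, hk0, hk1, hk2, hk3⟩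
  · exact five_on_plane hx hp (i := 0) (a := 1) (by decide) (by decide) h12 hf hk hf0 hf1 hf2 hf3
      hk0 hk1 hk2 hk3
  rcases coplanar_or_coplanar hw hw0 (a := 1) (b := 2) (c := 5) (d := 3) (e := 4) (g := 6)
    (by decide) with ⟨g, hg, hg0, hg1, hg2, hg3⟩ | ⟨g, hg, hg0, hg1, hg2, hg3⟩
  · exact five_on_plane hx hp (i := 0) (a := 1) (by decide) (by decide) h12 hf hg hf0 hf1 hf2 hf3
      hg0 hg1 hg2 hg3
  · exact five_on_plane hx hp (i := 0) (a := 3) (by decide) (by decide) h36 hk hg hk0 hk1 hk3 hk2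
      hg0 hg1 hg3 hg2

theorem quadric_relation_head {x : Fin 7 → Fin 4 → ℝ} (hx : DistinctProjectively x)
    (hp : NoneOnHypersurface 5 1 x) {w : Fin 7 → ℝ}
    (hw : ∀ f : Form 4 2, ∑ j, w j * evalAt 2 (x j) f = 0) : w 0 = 0 := by
  by_contra hw0
  rcases coplanar_or_coplanar hw hw0 (a := 1) (b := 2) (c := 3) (d := 4) (e := 5) (g := 6)
    (by decide) with h | h
  · exact not_coplanar hx hp hw hw0 h
  -- The involution exchanging the two triples reduces the second case to the first.
  · let σ : Equiv.Perm (Fin 7) := ⟨![0, 4, 5, 6, 1, 2, 3], ![0, 4, 5, 6, 1, 2, 3],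
      by decide, by decide⟩
    exact not_coplanar (hx.comp σ.injective) (hp.comp σ.injective) (w := fun i => w (σ i))
      (fun f => (Equiv.sum_comp σ fun i => w i * evalAt 2 (x i) f).trans (hw f)) hw0 h

end Space

end Form

/-! ### Cayley–Bacharach configurations from dimension counts. -/

namespace Form

open MvPolynomial Module

variable {n : ℕ}

/-- The multiples of the forms `q i`. -/
noncomputable def combination {m d : ℕ} (q : Fin m → Form n d) :
    (Fin m → Form n d) →ₗ[ℝ] Form n (2 * d) :=
  ∑ i, (mul (two_mul d).symm).flip (q i) ∘ₗ LinearMap.proj i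

theorem combination_apply {m d : ℕ} (q f : Fin m → Form n d) :
    combination q f = ∑ i, mul (two_mul d).symm (f i) (q i) := by
  simp [combination]

/-- A criterion for Cayley-Bacharach configurations in terms of dimensions. -/
theorem isCayleyBacharachConfig {m d K : ℕ} (hd : d ≠ 0) {v : Fin (K + 2) → Fin n → ℝ}
    {q : Fin m → Form n d} (hv : DistinctProjectively v) (hq : ∀ i j, evalAt d (v j) (q i) = 0)
    (hind : ∀ w : Fin (K + 2) → ℝ, (∀ f : Form n d, ∑ j, w j * evalAt d (v j) f = 0) →
      ∀ j, w j = 0 → w = 0)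
    (hli : LinearIndependent ℝ q) (hdim : finrank ℝ (Form n d) = K + 1 + m)
    (hrange : finrank ℝ (Form n (2 * d)) ≤
      finrank ℝ (LinearMap.range (combination q)) + (K + 2)) :
    IsCayleyBacharachConfig d K v q := by
  have hqle : Submodule.span ℝ (Set.range q) ≤
      LinearMap.ker (LinearMap.pi fun j => evalAt d (v j)) := by
    refine Submodule.span_le.mpr ?_
    rintro _ ⟨i, rfl⟩
    exact funext fun j => hq i j
  have hspan : LinearMap.ker (LinearMap.pi fun j => evalAt d (v j)) =
      Submodule.span ℝ (Set.range q) := by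
    refine (Submodule.eq_of_le_of_finrank_le hqle ?_).symm
    -- A relation on all points but the last extends by 0 to one that misses a point, so K + 1
    -- points already cut the dimension down to m.
    have h1 := finrank_vanishing (d := d) (fun j : Fin (K + 1) => v j.castSucc) fun w hw => by
      have h := hind (Fin.snoc w 0) (fun f => by simpa [Fin.sum_univ_castSucc] using hw f)
        (Fin.last _) (by simp)
      funext j
      simpa using congrFun h j.castSucc
    have h2 : LinearMap.ker (LinearMap.pi fun j => evalAt d (v j)) ≤
        LinearMap.ker (LinearMap.pi fun j : Fin (K + 1) => evalAt d (v j.castSucc)) := by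
      intro f hf
      exact funext fun j => congrFun hf j.castSucc
    have h3 := Submodule.finrank_mono h2
    have h4 := finrank_span_eq_card hli
    rw [Fintype.card_fin] at h1 h4
    omega
  have hrel : ∃ u, IsCayleyBacharach d v u := by
    by_contra! H
    have h1 := finrank_vanishing v fun w hw => by
      by_contra hne
      exact H w ⟨hne, hw⟩
    have h2 := Submodule.finrank_mono hqle
    have h4 := finrank_span_eq_card hli
    rw [Fintype.card_fin] at h1 h4
    omega
  refine ⟨hv, hq, fun f hf => ?_, fun F hF => ?_, hind, hrel⟩
  · rw [← hspan]
    exact funext hf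
  obtain ⟨u, hu⟩ := hrel
  have hu0 : ∀ j, u j ≠ 0 := fun j h => hu.1 (hind u hu.2 j h)
  -- In degree 2d all K + 2 points are independent: a form of degree d supported at j and k, times a
  -- power of a linear form vanishing at k but not at j, isolates j.
  have h1 := finrank_vanishing (d := 2 * d) v fun w hw => by
    funext j
    obtain ⟨k, hk⟩ := exists_ne j
    obtain ⟨f, hf⟩ := exists_evalAt_eq (d := d) v
      (fun i => if i = j then u k else if i = k then -u j else 0) fun w hw => by
        have hwu : w - (w 0 / u 0) • u = 0 := by
          refine hind _ (fun f => ?_) 0 (by simp [hu0])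
          simp only [Pi.sub_apply, Pi.smul_apply, smul_eq_mul, sub_mul, mul_assoc,
            Finset.sum_sub_distrib, ← Finset.mul_sum, hw f, hu.2 f, mul_zero, sub_zero]
        rw [sub_eq_zero.mp hwu, ← Finset.add_sum_erase _ _ (Finset.mem_univ j),
          ← Finset.add_sum_erase _ _ (Finset.mem_erase.mpr ⟨hk, Finset.mem_univ k⟩),
          Finset.sum_eq_zero]
        · simp [hk]; ring
        · intro i hi
          simp only [Finset.mem_erase] at hi
          simp [hi.1, hi.2.1]
    obtain ⟨b, hbk, hbj⟩ := exists_linear_separating (x := v k) (y := v j)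
      fun c hc => hk.symm (hv.2 _ _ c hc)
    let bp : Form n d := ⟨b.1 ^ d, by simpa using IsHomogeneous.pow b.2 d⟩
    have hbp : ∀ x, evalAt d x bp = evalAt 1 x b ^ d := fun x => by simp [evalAt_apply, bp]
    have h := hw (mul (two_mul d).symm f bp)
    rw [Finset.sum_eq_single j] at h
    · simpa [hbp, hf, hbj, hu0 k] using h
    · intro i _ hij
      by_cases hik : i = k
      · simp [hbp, hik, hbk, hd]
      · simp [hf, hij, hik]
    · simp
  have hle : LinearMap.range (combination q) ≤
      LinearMap.ker (LinearMap.pi fun j => evalAt (2 * d) (v j)) := by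
    rintro _ ⟨f, rfl⟩
    refine funext fun j => ?_
    simp [combination_apply, hq]
  have heq := Submodule.eq_of_le_of_finrank_le hle (by rw [Fintype.card_fin] at h1; omega)
  have hFm : F ∈ LinearMap.range (combination q) := by
    rw [heq]
    exact funext hF
  obtain ⟨f, rfl⟩ := hFm
  exact ⟨f, combination_apply q f⟩

/-- The points represented by `v` are exactly the common complex zeros of the forms `q i`. -/
def IsZeroLocus {m d N : ℕ} (v : Fin N → Fin n → ℝ) (q : Fin m → Form n d) : Prop :=
  ∀ z : Fin n → ℂ, z ≠ 0 → ((∀ i, aeval z (q i).1 = 0) ↔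
    ∃ j, ∃ c : ℂ, z = c • fun i => ((v j i : ℝ) : ℂ))

theorem IsZeroLocus.evalAt_eq_zero {m d N : ℕ} {v : Fin N → Fin n → ℝ} {q : Fin m → Form n d}
    (h : IsZeroLocus v q) (hv : DistinctProjectively v) (i : Fin m) (j : Fin N) :
    evalAt d (v j) (q i) = 0 := by
  have := (h (fun i => (v j i : ℂ)) fun h0 => hv.1 j (funext fun i => by
    simpa using congrFun h0 i)).mpr ⟨j, 1, (one_smul _ _).symm⟩ i
  rw [aeval_ofReal] at this
  exact_mod_cast this

/-- A common zero at which suitable linear forms do not vanish is impossible. -/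
theorem IsZeroLocus.exists_linear_eq_zero {m d N : ℕ} {v : Fin N → Fin n → ℝ}
    {q : Fin m → Form n d} (h : IsZeroLocus v q) {z : Fin n → ℂ} (hz : z ≠ 0)
    (hq : ∀ i, aeval z (q i).1 = 0) : ∃ j, ∃ c : ℂ, c ≠ 0 ∧
      ∀ g : Form n 1, aeval z g.1 = c * evalAt 1 (v j) g := by
  obtain ⟨j, c, rfl⟩ := (h z hz).mp hq
  refine ⟨j, c, by rintro rfl; simp at hz, fun g => ?_⟩
  rw [aeval_smul_point, aeval_ofReal, pow_one]

theorem exists_forall_evalAt_ne_zero {ι : Type*} [Fintype ι] {d : ℕ} (f : ι → Form n d)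
    (hf : ∀ i, f i ≠ 0) : ∃ x, ∀ i, evalAt d x (f i) ≠ 0 := by
  have hprod : ∏ i, (f i).1 ≠ 0 :=
    Finset.prod_ne_zero_iff.mpr fun i _ h => hf i (Subtype.ext h)
  by_contra! H
  refine hprod (MvPolynomial.funext fun x => ?_)
  obtain ⟨i, hi⟩ := H x
  rw [map_zero, map_prod]
  refine Finset.prod_eq_zero (Finset.mem_univ i) ?_
  simpa [evalAt_apply, aeval_eq_eval] using hi

/-- The coefficient in degree d is the value at the point at infinity of the line, which is needed
to exclude common zeros there. -/
theorem lineRestrict_degree {d : ℕ} (x t : Fin n → ℝ) (f : Form n d) :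
    (lineRestrict x t f.1).natDegree ≤ d ∧ (lineRestrict x t f.1).coeff d = evalAt d t f := by
  have hlin : ∀ g : Form n 1, (lineRestrict x t g.1).natDegree ≤ 1 ∧
      (lineRestrict x t g.1).coeff 1 = evalAt 1 t g := by
    intro g
    have hg : g.1 ∈ Submodule.span ℝ (Set.range (X : Fin n → MvPolynomial (Fin n) ℝ)) := by
      rw [← homogeneousSubmodule_one_eq_span_X]; exact g.2
    rw [evalAt_apply]
    generalize g.1 = G at hg ⊢
    induction hg using Submodule.span_induction with
    | mem p hp =>
      obtain ⟨i, rfl⟩ := hp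
      constructor
      · simp only [lineRestrict, aeval_X]
        compute_degree
      · simp [lineRestrict]
    | zero => simp
    | add p q _ _ hp hq =>
      simp only [map_add, Polynomial.coeff_add, hp.2, hq.2, and_true]
      exact Polynomial.natDegree_add_le_of_degree_le hp.1 hq.1
    | smul c p _ hp =>
      simp only [map_smul, Polynomial.coeff_smul, hp.2, and_true]
      exact (Polynomial.natDegree_smul_le _ _).trans hp.1
  induction d with
  | zero =>
    obtain ⟨F, hF⟩ := f
    rw [mem_homogeneousSubmodule, ← totalDegree_zero_iff_isHomogeneous,
      totalDegree_eq_zero_iff_eq_C] at hF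
    rw [evalAt_apply]
    simp only
    rw [hF]
    simp [lineRestrict, Polynomial.algebraMap_eq]
  | succ d ih =>
    induction f using induction_mul_linear (Nat.add_comm 1 d) with
    | h0 => simp
    | hadd f g hf hg =>
      simp only [Submodule.coe_add, map_add, Polynomial.coeff_add, hf.2, hg.2, and_true]
      exact Polynomial.natDegree_add_le_of_degree_le hf.1 hg.1
    | hsmul c f hf =>
      simp only [Submodule.coe_smul, map_smul, Polynomial.coeff_smul, hf.2, and_true]
      exact (Polynomial.natDegree_smul_le _ _).trans hf.1
    | hmul g f =>
      rw [coe_mul, map_mul, evalAt_mul]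
      constructor
      · exact Polynomial.natDegree_mul_le.trans
          (by have := (hlin g).1; have := (ih f).1; omega)
      · rw [Nat.add_comm d 1, Polynomial.coeff_mul_add_eq_of_natDegree_le (hlin g).1 (ih f).1,
          (hlin g).2, (ih f).2]

/-- Univariate polynomials without common complex root have only the obvious syzygies. -/
theorem exists_const_of_syzygy {d : ℕ} {B₁ B₂ F G : Polynomial ℝ}
    (hroot : ∀ t : ℂ, ¬ (Polynomial.aeval t B₁ = 0 ∧ Polynomial.aeval t B₂ = 0))
    (hd : d ≠ 0) (h₁ : B₁.natDegree ≤ d) (h₂ : B₂.natDegree ≤ d)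
    (hlead : B₁.coeff d ≠ 0 ∨ B₂.coeff d ≠ 0)
    (hF : F.natDegree ≤ d) (hG : G.natDegree ≤ d) (hs : F * B₁ + G * B₂ = 0) :
    ∃ c : ℝ, F = Polynomial.C c * B₂ ∧ G = -(Polynomial.C c * B₁) := by
  have hcop : IsCoprime B₁ B₂ := by
    rw [Polynomial.isCoprime_iff_aeval_ne_zero_of_isAlgClosed ℝ ℂ]
    intro t
    by_contra! H
    exact hroot t H
  have hB₂ : B₂ ≠ 0 := by
    rintro rfl
    have := Polynomial.natDegree_eq_zero_of_isUnit (isCoprime_zero_right.mp hcop)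
    rcases hlead with h | h
    · exact h (Polynomial.coeff_eq_zero_of_natDegree_lt (by omega))
    · simp at h
  obtain ⟨c, hc⟩ : B₂ ∣ F :=
    hcop.symm.dvd_of_dvd_mul_right ⟨-G, by linear_combination hs⟩
  have hG' : G = -(c * B₁) := by
    have : B₂ * (G + c * B₁) = 0 := by rw [hc] at hs; linear_combination hs
    have := (mul_eq_zero.mp this).resolve_left hB₂
    linear_combination this
  -- One of `B₁`, `B₂` has degree exactly d, so the bounds on F and G leave no room for a
  -- nonconstant factor.
  have hc0 : c.natDegree = 0 := by
    by_cases hcz : c = 0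
    · simp [hcz]
    rcases hlead with h | h
    · have hB : B₁ ≠ 0 := by rintro rfl; simp at h
      have := Polynomial.le_natDegree_of_ne_zero h
      rw [hG', Polynomial.natDegree_neg, Polynomial.natDegree_mul hcz hB] at hG
      omega
    · have := Polynomial.le_natDegree_of_ne_zero h
      rw [hc, Polynomial.natDegree_mul hB₂ hcz] at hF
      omega
  rw [Polynomial.eq_C_of_natDegree_eq_zero hc0] at hc hG'
  exact ⟨_, by rw [hc, mul_comm], hG'⟩

/-! ### Syzygies of two plane curves and the nine points of two cubics. -/

section Plane

/-- The syzygies of two ternary forms of degree `d` with finitely many common zeros. -/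
theorem exists_eq_smul_of_syzygy {d N : ℕ} (hd : d ≠ 0) {v : Fin (N + 1) → Fin 3 → ℝ}
    {q : Fin 2 → Form 3 d} (hq : IsZeroLocus v q) {f g : Form 3 d}
    (hs : f.1 * (q 0).1 + g.1 * (q 1).1 = 0) : ∃ c : ℝ, f = c • q 1 ∧ g = -(c • q 0) := by
  choose ℓ hℓ hℓv using fun j => exists_form_vanishing (d := 1) (fun _ : Fin 1 => v j)
    (by rw [finrank_eq]; decide)
  obtain ⟨x₀, hx₀⟩ := exists_forall_evalAt_ne_zero ℓ hℓ
  -- `x₀` lies off the points, and `k j` is a line joining it to `v j`. For x on none of these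
  -- lines, the line through `x₀` and x misses every common zero of the two forms.
  choose k hk hkv using fun j => exists_form_vanishing (d := 1) ![v j, x₀]
    (by rw [finrank_eq]; decide)
  have hkv' : ∀ j, evalAt 1 (v j) (k j) = 0 := fun j => hkv j 0
  have hkx : ∀ j, evalAt 1 x₀ (k j) = 0 := fun j => hkv j 1
  have hℓv' : ∀ j, evalAt 1 (v j) (ℓ j) = 0 := fun j => hℓv j 0
  -- the value of the constant at `x₀`
  let c₀ := (evalAt d x₀ f * evalAt d x₀ (q 1) - evalAt d x₀ g * evalAt d x₀ (q 0)) /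
    (evalAt d x₀ (q 0) ^ 2 + evalAt d x₀ (q 1) ^ 2)
  have hx₀0 : x₀ ≠ 0 := by
    rintro rfl
    exact hx₀ 0 (map_zero (toDual (ℓ 0)))
  have key : ∀ x, (∀ j, evalAt 1 x (k j) ≠ 0) →
      evalAt d x f = c₀ * evalAt d x (q 1) ∧ evalAt d x g = -(c₀ * evalAt d x (q 0)) := by
    intro x hx
    have hpt : ∀ (s : ℂ) (g : Form 3 1),
        aeval (fun i => algebraMap ℝ ℂ (x₀ i) + algebraMap ℝ ℂ ((x - x₀) i) * s) g.1 =
        (1 - s) * (evalAt 1 x₀ g : ℂ) + s * (evalAt 1 x g : ℂ) := by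
      intro s g
      rw [← aeval_ofReal, ← aeval_ofReal, ← aeval_linear_combination]
      congr 2
      ext i
      simp
      ring
    have hroot : ∀ s : ℂ, ¬ (Polynomial.aeval s (lineRestrict x₀ (x - x₀) (q 0).1) = 0 ∧
        Polynomial.aeval s (lineRestrict x₀ (x - x₀) (q 1).1) = 0) := by
      rintro s ⟨h0, h1⟩
      rw [aeval_lineRestrict] at h0 h1
      have hs0 : ∀ j, aeval (fun i => algebraMap ℝ ℂ (x₀ i) + algebraMap ℝ ℂ ((x - x₀) i) * s)
          (k j).1 = 0 → s = 0 := by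
        intro j hj
        rw [hpt, hkx] at hj
        simpa [hx j] using hj
      by_cases hz : (fun i => algebraMap ℝ ℂ (x₀ i) + algebraMap ℝ ℂ ((x - x₀) i) * s) = 0
      · have hs : s = 0 := by
          refine hs0 0 ?_
          rw [hz]
          simpa using aeval_smul_point 0 0 (k 0)
        subst hs
        have h2 := hpt 0 (ℓ 0)
        rw [hz] at h2
        have h3 : aeval (0 : Fin 3 → ℂ) (ℓ 0).1 = 0 := by simpa using aeval_smul_point 0 0 (ℓ 0)
        rw [h3] at h2
        exact hx₀ 0 (by simpa using h2.symm)
      · obtain ⟨j, c, hc, hg⟩ := hq.exists_linear_eq_zero hz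
          (by intro i; fin_cases i <;> assumption)
        have hs : s = 0 := hs0 j (by rw [hg, hkv']; simp)
        subst hs
        have h2 := hg (ℓ j)
        rw [hpt, hℓv'] at h2
        exact hx₀ j (by simpa using h2)
    -- The same argument at the remaining point x - `x₀` of the projective line, which the parameter
    -- s does not reach.
    have hlead : evalAt d (x - x₀) (q 0) ≠ 0 ∨ evalAt d (x - x₀) (q 1) ≠ 0 := by
      by_contra! H
      have hz : (fun i => (((x - x₀) i : ℝ) : ℂ)) ≠ 0 := by
        intro h
        have : x = x₀ := by
          refine sub_eq_zero.mp (funext fun i => ?_)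
          have := congrFun h i
          simpa only [Pi.zero_apply, Complex.ofReal_eq_zero] using this
        exact hx 0 (this ▸ hkx 0)
      obtain ⟨j, c, hc, hg⟩ := hq.exists_linear_eq_zero hz (by
        intro i
        rw [aeval_ofReal]
        fin_cases i
        · exact_mod_cast H.1
        · exact_mod_cast H.2)
      have h2 := hg (k j)
      rw [aeval_ofReal, hkv', Complex.ofReal_zero, mul_zero] at h2
      have h3 : evalAt 1 (x - x₀) (k j) = 0 := by exact_mod_cast h2
      have h4 := evalAt_linear_combination (k j) 1 (-1) x x₀
      rw [hkx, one_smul, neg_one_smul, ← sub_eq_add_neg, h3] at h4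
      exact hx j (by linarith)
    obtain ⟨c, hcF, hcG⟩ := exists_const_of_syzygy hroot hd (lineRestrict_degree _ _ _).1
      (lineRestrict_degree _ _ _).1
      (by rwa [(lineRestrict_degree _ _ _).2, (lineRestrict_degree _ _ _).2])
      (lineRestrict_degree x₀ (x - x₀) f).1 (lineRestrict_degree x₀ (x - x₀) g).1
      (by rw [← map_mul, ← map_mul, ← map_add, hs, map_zero])
    have hev : ∀ (s : ℝ), evalAt d (x₀ + s • (x - x₀)) f = c * evalAt d (x₀ + s • (x - x₀)) (q 1) ∧
        evalAt d (x₀ + s • (x - x₀)) g = -(c * evalAt d (x₀ + s • (x - x₀)) (q 0)) := by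
      intro s
      simp only [evalAt_apply, ← eval_lineRestrict]
      rw [hcF, hcG]
      simp
    have e0 := hev 0
    have e1 := hev 1
    simp only [zero_smul, add_zero, one_smul, add_sub_cancel] at e0 e1
    -- All these lines pass through `x₀`, so the constant is determined there and does not depend on
    -- x.
    have hc : c = c₀ := by
      have hne : evalAt d x₀ (q 0) ^ 2 + evalAt d x₀ (q 1) ^ 2 ≠ 0 := by
        intro h
        have h0 : evalAt d x₀ (q 0) = 0 :=
            by nlinarith [sq_nonneg (evalAt d x₀ (q 0)), sq_nonneg (evalAt d x₀ (q 1))]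
        have h1 : evalAt d x₀ (q 1) = 0 :=
            by nlinarith [sq_nonneg (evalAt d x₀ (q 0)), sq_nonneg (evalAt d x₀ (q 1))]
        refine hroot 0 ⟨?_, ?_⟩ <;> rw [aeval_lineRestrict]
        · simpa [h0] using aeval_ofReal x₀ (q 0)
        · simpa [h1] using aeval_ofReal x₀ (q 1)
      simp only [c₀]
      rw [eq_div_iff hne, e0.1, e0.2]
      ring
    rwa [← hc]
  -- Density: F times the product of all `k j` vanishes everywhere.
  have hzero : ∀ F : Form 3 d, (∀ x, (∀ j, evalAt 1 x (k j) ≠ 0) → evalAt d x F = 0) → F = 0 := by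
    intro F hF
    by_contra hne
    have hprod : F.1 * ∏ j, (k j).1 ≠ 0 := mul_ne_zero (fun h => hne (Subtype.ext h))
      (Finset.prod_ne_zero_iff.mpr fun i _ h => hk i (Subtype.ext h))
    refine hprod (MvPolynomial.funext fun x => ?_)
    rw [map_zero, map_mul, map_prod]
    by_cases hx : ∀ j, evalAt 1 x (k j) ≠ 0
    · rw [show eval x F.1 = 0 by simpa [evalAt_apply, aeval_eq_eval] using hF x hx, zero_mul]
    · push Not at hx
      obtain ⟨j, hj⟩ := hx
      rw [Finset.prod_eq_zero (Finset.mem_univ j), mul_zero]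
      simpa [evalAt_apply, aeval_eq_eval] using hj
  refine ⟨c₀, sub_eq_zero.mp (hzero _ fun x hx => ?_), sub_eq_zero.mp (hzero _ fun x hx => ?_)⟩
  · simp [(key x hx).1]
  · simp [(key x hx).2]

/-- The nine points of intersection of two cubics. -/
theorem isCayleyBacharachConfig_cubics {v : Fin 9 → Fin 3 → ℝ} {q : Fin 2 → Form 3 3}
    (hv : DistinctProjectively v) (hq : IsZeroLocus v q) (hl : NoneOnHypersurface 4 1 v)
    (hc : NoneOnHypersurface 7 2 v) : IsCayleyBacharachConfig 3 7 v q := by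
  have hdim : finrank ℝ (Form 3 3) = 10 := by rw [finrank_eq]; rfl
  have hsyz : ∀ f g : Form 3 3, f.1 * (q 0).1 + g.1 * (q 1).1 = 0 →
      ∃ c : ℝ, f = c • q 1 ∧ g = -(c • q 0) := fun f g =>
    exists_eq_smul_of_syzygy three_ne_zero hq
  have hnot : ∀ f : Form 3 3, ¬ ∀ r : Form 3 3, r ∈ Submodule.span ℝ {f} := fun f H => by
    have h1 := finrank_span_le_card (R := ℝ) ({f} : Set (Form 3 3))
    rw [(Submodule.eq_top_iff' (p := Submodule.span ℝ {f})).mpr H, finrank_top, hdim] at h1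
    simp at h1
  refine isCayleyBacharachConfig three_ne_zero hv (hq.evalAt_eq_zero hv)
    (fun w hw j hj => eq_zero_of_relation (fun τ hτ w hw =>
      cubic_relation_head (hv.comp hτ) (hl.comp hτ) (hc.comp hτ) hw) w hw j hj) ?_ hdim ?_
  · rw [Fintype.linearIndependent_iff]
    intro a ha
    rw [Fin.sum_univ_two] at ha
    -- A linear dependence multiplied by an arbitrary cubic r is a syzygy, so a nonzero coefficient
    -- would put all ten dimensions of cubics into one line.
    have h := fun r : Form 3 3 => hsyz (a 0 • r) (a 1 • r) (by
      have := congrArg (fun F : Form 3 3 => r.1 * F.1) ha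
      simp only [Submodule.coe_add, Submodule.coe_smul, Submodule.coe_zero, mul_zero, mul_add,
        mul_smul_comm] at this ⊢
      rw [← this, smul_mul_assoc, smul_mul_assoc])
    have h0 : ∀ (b : ℝ) (f : Form 3 3), (∀ r : Form 3 3, ∃ c : ℝ, b • r = c • f) → b = 0 := by
      intro b f H
      by_contra hb
      refine hnot f fun r => ?_
      obtain ⟨c, hc⟩ := H r
      exact Submodule.mem_span_singleton.mpr ⟨b⁻¹ * c, by rw [mul_smul, ← hc, inv_smul_smul₀ hb]⟩
    intro i
    fin_cases i
    · exact h0 _ (q 1) fun r => (h r).imp fun _ h => h.1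
    · exact h0 _ (-q 0) fun r => (h r).imp fun _ h => by simpa using h.2
  · have h1 := LinearMap.finrank_range_add_finrank_ker (combination q)
    -- Only the obvious syzygy remains, so the range has dimension at least 20 - 1 = 28 - 9.
    have h2 : LinearMap.ker (combination q) ≤ Submodule.span ℝ {![q 1, -q 0]} := by
      intro f hf
      have hf' := congrArg Subtype.val ((combination_apply q f).symm.trans hf)
      rw [Fin.sum_univ_two] at hf'
      obtain ⟨c, h0, h1⟩ := hsyz (f 0) (f 1) hf'
      refine Submodule.mem_span_singleton.mpr ⟨c, ?_⟩
      funext i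
      fin_cases i <;> simp [h0, h1]
    have h3 := (Submodule.finrank_mono h2).trans (finrank_span_le_card _)
    have h4 : finrank ℝ (Form 3 (2 * 3)) = 28 := by rw [finrank_eq]; rfl
    have h5 : finrank ℝ (Fin 2 → Form 3 3) = 20 := by rw [finrank_pi_fintype]; simp [hdim]
    simp at h3
    omega

end Plane

end Form

/-! ### Pencils in odd dimension and complex zeros of binary quadratics. -/

open Module

theorem Polynomial.exists_isRoot_of_odd_natDegree {P : Polynomial ℝ} (hP : P.Monic)
    (hodd : Odd P.natDegree) : ∃ x, P.IsRoot x := by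
  have hdeg : 0 < P.degree := Polynomial.natDegree_pos_iff_degree_pos.mp hodd.pos
  have htop := P.tendsto_atTop_of_leadingCoeff_nonneg hdeg (by rw [hP.leadingCoeff]; norm_num)
  have hdeg' : (P.comp (-Polynomial.X)).natDegree = P.natDegree := by
    rw [Polynomial.natDegree_comp, Polynomial.natDegree_neg, Polynomial.natDegree_X, mul_one]
  have hbot := (P.comp (-Polynomial.X)).tendsto_atBot_of_leadingCoeff_nonpos
    (Polynomial.natDegree_pos_iff_degree_pos.mp (hdeg'.symm ▸ hodd.pos))
    (by
      rw [Polynomial.leadingCoeff_comp (by simp), hP.leadingCoeff]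
      simp [hodd.neg_one_pow])
  obtain ⟨a, ha⟩ := (htop.eventually (Filter.eventually_ge_atTop 0)).exists
  obtain ⟨b, hb⟩ := (hbot.eventually (Filter.eventually_le_atBot 0)).exists
  simp only [Polynomial.eval_comp, Polynomial.eval_neg, Polynomial.eval_X] at hb
  exact mem_range_of_exists_le_of_exists_ge P.continuous ⟨_, hb⟩ ⟨_, ha⟩

/-- A pencil of linear maps between real vector spaces of the same odd dimension has a singular
member. -/
theorem LinearMap.exists_pencil_apply_eq_zero {V W : Type*} [AddCommGroup V] [Module ℝ V]
    [FiniteDimensional ℝ V] [AddCommGroup W] [Module ℝ W] [FiniteDimensional ℝ W]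
    (hVW : finrank ℝ V = finrank ℝ W) (hodd : Odd (finrank ℝ V)) (A B : V →ₗ[ℝ] W) :
    ∃ s t : ℝ, (s ≠ 0 ∨ t ≠ 0) ∧ ∃ x : V, x ≠ 0 ∧ s • A x + t • B x = 0 := by
  by_cases hB : Function.Injective B
  · let e := LinearEquiv.ofInjectiveOfFinrankEq B hB hVW
    have he : ∀ x, e x = B x := fun _ => rfl
    let T : End ℝ V := e.symm.toLinearMap ∘ₗ A
    -- For invertible B the singular members A - rB come from real eigenvalues r of B⁻¹A; one exists
    -- because the characteristic polynomial has odd degree.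
    obtain ⟨r, hr⟩ := Polynomial.exists_isRoot_of_odd_natDegree (LinearMap.charpoly_monic T)
      (by rwa [LinearMap.charpoly_natDegree])
    obtain ⟨x, hx⟩ := ((End.hasEigenvalue_iff_isRoot_charpoly T r).mpr hr).exists_hasEigenvector
    refine ⟨1, -r, Or.inl one_ne_zero, x, hx.2, ?_⟩
    have h1 : e.symm (A x) = r • x := hx.apply_eq_smul
    have h2 : A x = r • B x := by
      rw [← he, ← map_smul, ← h1, LinearEquiv.apply_symm_apply]
    rw [h2]; simp
  · rw [← LinearMap.ker_eq_bot] at hB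
    obtain ⟨x, hx, hx0⟩ := Submodule.exists_mem_ne_zero_of_ne_bot hB
    exact ⟨0, 1, Or.inr one_ne_zero, x, hx0, by simpa using hx⟩

theorem Complex.exists_binary_quadratic_zero (a b c : ℂ) :
    ∃ x y : ℂ, (x ≠ 0 ∨ y ≠ 0) ∧ x ^ 2 * a + x * y * b + y ^ 2 * c = 0 := by
  by_cases ha : a = 0
  · exact ⟨1, 0, Or.inl one_ne_zero, by simp [ha]⟩
  · obtain ⟨s, hs⟩ := IsAlgClosed.exists_pow_nat_eq (discrim a b c) (n := 2) (by norm_num)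
    obtain ⟨x, hx⟩ := exists_quadratic_eq_zero ha ⟨s, by rw [← hs, sq]⟩
    exact ⟨x, 1, Or.inr one_ne_zero, by linear_combination hx⟩

/-- Real vectors that are linearly independent over `ℝ` are so over `ℂ`. -/
theorem LinearIndependent.complex_combination {n k : ℕ} {b : Fin k → Fin n → ℝ}
    (hb : LinearIndependent ℝ b) {c : Fin k → ℂ}
    (hc : ∑ j, c j • (fun i => (b j i : ℂ)) = 0) (j : Fin k) : c j = 0 := by
  have h1 := Fintype.linearIndependent_iff.mp hb (fun j => (c j).re) (by
    funext i
    have := congrArg Complex.re (congrFun hc i)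
    simpa [Finset.sum_apply] using this) j
  have h2 := Fintype.linearIndependent_iff.mp hb (fun j => (c j).im) (by
    funext i
    have := congrArg Complex.im (congrFun hc i)
    simpa [Finset.sum_apply] using this) j
  exact Complex.ext h1 h2

/-- A subspace of dimension at least three contains an independent triple that extends a given
independent family. -/
theorem Submodule.exists_linearIndependent_triple {V : Type*} [AddCommGroup V] [Module ℝ V]
    [FiniteDimensional ℝ V] (N : Submodule ℝ V) (hN : 3 ≤ finrank ℝ N) {x : V} (hx : x ∈ N)
    (hx0 : x ≠ 0) : ∃ y ∈ N, ∃ z ∈ N, LinearIndependent ℝ ![z, y, x] := by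
  have h1 : LinearIndependent ℝ ![(⟨x, hx⟩ : N)] := by
    rw [linearIndependent_unique_iff]
    exact fun h => hx0 (congrArg Subtype.val h)
  obtain ⟨y, hy⟩ := exists_linearIndependent_cons_of_lt_finrank h1 (by omega)
  obtain ⟨z, hz⟩ := exists_linearIndependent_cons_of_lt_finrank hy (by omega)
  refine ⟨y, y.2, z, z.2, ?_⟩
  convert! hz.map' N.subtype (Submodule.ker_subtype N) using 1
  funext i
  fin_cases i <;> rfl

/-! ### Polar forms and common zeros of two quadrics on a plane. -/

namespace Form

open MvPolynomial Module

variable {n : ℕ}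

/-- The polar form of a quadratic form. -/
noncomputable def polar (x y : Fin n → ℝ) : Form n 2 →ₗ[ℝ] ℝ :=
  evalAt 2 (x + y) - evalAt 2 x - evalAt 2 y

theorem polar_mul (x y : Fin n → ℝ) (g f : Form n 1) :
    polar x y (mul rfl g f) = evalAt 1 x g * evalAt 1 y f + evalAt 1 y g * evalAt 1 x f := by
  have h := fun g : Form n 1 => evalAt_linear_combination g 1 1 x y
  simp only [one_smul, one_mul] at h
  simp only [polar, LinearMap.sub_apply, evalAt_mul, h]
  ring

theorem polar_self (x : Fin n → ℝ) (f : Form n 2) : polar x x f = 2 * evalAt 2 x f := by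
  induction f using induction_mul_linear (k := 1) rfl with
  | h0 => simp
  | hadd f g hf hg => simp only [map_add, hf, hg]; ring
  | hsmul c f hf => simp only [map_smul, hf, smul_eq_mul]; ring
  | hmul g f => rw [polar_mul, evalAt_mul]; ring

theorem polar_comm (x y : Fin n → ℝ) (f : Form n 2) : polar x y f = polar y x f := by
  simp only [polar, LinearMap.sub_apply, add_comm x y]
  ring

theorem polar_linear_combination (x y z : Fin n → ℝ) (a b : ℝ) (f : Form n 2) :
    polar x (a • y + b • z) f = a * polar x y f + b * polar x z f := by
  induction f using induction_mul_linear (k := 1) rfl with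
  | h0 => simp
  | hadd f g hf hg => simp only [map_add, hf, hg]; ring
  | hsmul c f hf => simp only [map_smul, hf, smul_eq_mul]; ring
  | hmul g f =>
    simp only [polar_mul, evalAt_linear_combination]
    ring

/-- The polar form as a linear map to the dual space. -/
noncomputable def polarMap (f : Form n 2) : (Fin n → ℝ) →ₗ[ℝ] Dual ℝ (Fin n → ℝ) :=
  LinearMap.mk₂ ℝ (fun x y => polar x y f)
    (fun x y z => by
      have := polar_linear_combination z x y 1 1 f
      simp only [one_smul, one_mul] at this
      rw [polar_comm, this, polar_comm z x, polar_comm z y])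
    (fun a x z => by
      have := polar_linear_combination z x 0 a 0 f
      simp only [zero_smul, zero_mul, add_zero] at this
      rw [polar_comm, this, polar_comm z x, smul_eq_mul])
    (fun x y z => by
      have := polar_linear_combination x y z 1 1 f
      simpa only [one_smul, one_mul] using this)
    (fun a x z => by
      have := polar_linear_combination x z 0 a 0 f
      simpa only [zero_smul, zero_mul, add_zero, smul_eq_mul] using this)

theorem aeval_quadratic (f : Form n 2) (x y z : Fin n → ℝ) (a b c : ℂ) :
    aeval (a • (fun i => (x i : ℂ)) + b • (fun i => (y i : ℂ)) + c • fun i => (z i : ℂ)) f.1 =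
      a ^ 2 * (evalAt 2 x f : ℂ) + b ^ 2 * (evalAt 2 y f : ℂ) + c ^ 2 * (evalAt 2 z f : ℂ) +
      a * b * (polar x y f : ℂ) + a * c * (polar x z f : ℂ) + b * c * (polar y z f : ℂ) := by
  have hlin : ∀ g : Form n 1, aeval (a • (fun i => (x i : ℂ)) + b • (fun i => (y i : ℂ)) +
      c • fun i => (z i : ℂ)) g.1 = a * (evalAt 1 x g : ℂ) + b * (evalAt 1 y g : ℂ) +
      c * (evalAt 1 z g : ℂ) := by
    intro g
    have h1 := aeval_linear_combination g 1 c (a • (fun i => (x i : ℂ)) + b • (fun i => (y i : ℂ)))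
      (fun i => (z i : ℂ))
    rw [one_smul, one_mul, aeval_linear_combination] at h1
    simpa only [aeval_ofReal] using h1
  induction f using induction_mul_linear (k := 1) rfl with
  | h0 => simp
  | hadd f g hf hg =>
    simp only [map_add, Submodule.coe_add, hf, hg, Complex.ofReal_add]; ring
  | hsmul s f hf =>
    simp only [map_smul, Submodule.coe_smul, hf, smul_eq_mul, Complex.ofReal_mul,
      Complex.real_smul]
    ring
  | hmul g f =>
    simp only [coe_mul, map_mul, hlin, polar_mul, evalAt_mul, Complex.ofReal_add,
      Complex.ofReal_mul]
    ring

/-- Two real quadrics in space have a common complex zero on every real plane. -/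
theorem exists_common_zero_on_plane (Q₁ Q₂ : Form 4 2) {h : Form 4 1} (hh : h ≠ 0) :
    ∃ z : Fin 4 → ℂ, z ≠ 0 ∧ aeval z h.1 = 0 ∧ aeval z Q₁.1 = 0 ∧ aeval z Q₂.1 = 0 := by
  let E := LinearMap.ker (toDual h)
  have hE : finrank ℝ E = 3 := by
    have h1 : toDual h ≠ 0 := fun h0 => hh ((dualEquiv 4).map_eq_zero_iff.mp h0)
    have := Module.Dual.finrank_ker_add_one_of_ne_zero h1
    simp only [finrank_fintype_fun_eq_card, Fintype.card_fin] at this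
    exact Nat.succ_injective this
  let A : Form 4 2 → E →ₗ[ℝ] Dual ℝ E := fun Q =>
    (E.subtype.dualMap ∘ₗ polarMap Q) ∘ₗ E.subtype
  have hA : ∀ Q (x y : E), A Q x y = polar x.1 y.1 Q := fun _ _ _ => rfl
  -- The plane corresponds to a space of dimension 3, so some real member of the pencil of conics is
  -- singular, with vertex w.
  obtain ⟨s, t, hst, w, hw0, hw⟩ := LinearMap.exists_pencil_apply_eq_zero
    (by rw [Subspace.dual_finrank_eq]) (by rw [hE]; decide) (A Q₁) (A Q₂)
  have hwQ : ∀ y : E, polar w.1 y.1 (s • Q₁ + t • Q₂) = 0 := fun y => by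
    have := LinearMap.congr_fun hw y
    simpa only [LinearMap.add_apply, LinearMap.smul_apply, hA, LinearMap.zero_apply, map_add,
      map_smul] using this
  obtain ⟨e₁, -, e₂, -, hli⟩ := (⊤ : Submodule ℝ E).exists_linearIndependent_triple
    (by rw [finrank_top, hE]) (Submodule.mem_top (x := w)) hw0
  have hww : evalAt 2 w.1 (s • Q₁ + t • Q₂) = 0 := by
    have := hwQ w
    rw [polar_self] at this
    linarith
  have hli' : LinearIndependent ℝ ![e₂.1, e₁.1, w.1] := by
    convert! hli.map' E.subtype (Submodule.ker_subtype E) using 1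
    funext i
    fin_cases i <;> rfl
  obtain ⟨α, β, hαβ, h0⟩ := Complex.exists_binary_quadratic_zero
    (evalAt 2 e₂.1 (s • Q₁ + t • Q₂) : ℂ) (polar e₂.1 e₁.1 (s • Q₁ + t • Q₂) : ℂ)
    (evalAt 2 e₁.1 (s • Q₁ + t • Q₂) : ℂ)
  -- The singular conic is a cone over its zero (α, β) on the complementary line, so it contains the
  -- whole complex line joining that zero to w.
  have hpen : ∀ γ δ : ℂ, aeval ((δ * α) • (fun i => (e₂.1 i : ℂ)) +
      (δ * β) • (fun i => (e₁.1 i : ℂ)) + γ • fun i => (w.1 i : ℂ)) (s • Q₁ + t • Q₂).1 = 0 := by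
    intro γ δ
    rw [aeval_quadratic, hww, polar_comm e₂.1 w.1, polar_comm e₁.1 w.1, hwQ, hwQ]
    simp only [Complex.ofReal_zero]
    linear_combination δ ^ 2 * h0
  -- On this complex line any further quadric is a binary quadratic and has a zero.
  have hother : ∀ Q : Form 4 2, ∃ γ δ : ℂ, (γ ≠ 0 ∨ δ ≠ 0) ∧
      aeval ((δ * α) • (fun i => (e₂.1 i : ℂ)) +
      (δ * β) • (fun i => (e₁.1 i : ℂ)) + γ • fun i => (w.1 i : ℂ)) Q.1 = 0 := by
    intro Q
    obtain ⟨γ, δ, hne, h1⟩ := Complex.exists_binary_quadratic_zero (evalAt 2 w.1 Q : ℂ)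
      (α * (polar e₂.1 w.1 Q : ℂ) + β * (polar e₁.1 w.1 Q : ℂ))
      (α ^ 2 * (evalAt 2 e₂.1 Q : ℂ) + β ^ 2 * (evalAt 2 e₁.1 Q : ℂ) +
        α * β * (polar e₂.1 e₁.1 Q : ℂ))
    refine ⟨γ, δ, hne, ?_⟩
    rw [aeval_quadratic]
    linear_combination h1
  have hfinal : ∀ γ δ : ℂ, (γ ≠ 0 ∨ δ ≠ 0) → ((δ * α) • (fun i => (e₂.1 i : ℂ)) +
      (δ * β) • (fun i => (e₁.1 i : ℂ)) + γ • fun i => (w.1 i : ℂ)) ≠ 0 ∧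
      aeval ((δ * α) • (fun i => (e₂.1 i : ℂ)) +
      (δ * β) • (fun i => (e₁.1 i : ℂ)) + γ • fun i => (w.1 i : ℂ)) h.1 = 0 := by
    intro γ δ hne
    constructor
    · intro hz
      have := hli'.complex_combination (c := ![δ * α, δ * β, γ])
        (by rw [Fin.sum_univ_three]; exact hz)
      have h0 : δ * α = 0 := this 0
      have h1 : δ * β = 0 := this 1
      have h2 : γ = 0 := this 2
      have h3 : δ ≠ 0 := by simpa [h2] using hne
      simp only [mul_eq_zero, h3, false_or] at h0 h1
      simp [h0, h1] at hαβ
    · have hz : ∀ e : E, aeval (fun i => (e.1 i : ℂ)) h.1 = 0 := fun e => by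
        rw [aeval_ofReal]
        have : evalAt 1 e.1 h = 0 := e.2
        rw [this, Complex.ofReal_zero]
      have h1 := aeval_linear_combination h 1 γ ((δ * α) • (fun i => (e₂.1 i : ℂ)) +
        (δ * β) • (fun i => (e₁.1 i : ℂ))) (fun i => (w.1 i : ℂ))
      rw [one_smul] at h1
      rw [h1, aeval_linear_combination, hz, hz, hz]
      ring
  -- Take the zero of the quadric that can be eliminated from the singular member; the coefficient
  -- of the other one is nonzero.
  rcases hst with hs | ht
  · obtain ⟨γ, δ, hne, h2⟩ := hother Q₂
    have h1 := hpen γ δ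
    rw [Submodule.coe_add, Submodule.coe_smul, Submodule.coe_smul, map_add, map_smul, map_smul, h2,
      smul_zero, add_zero] at h1
    exact ⟨_, (hfinal γ δ hne).1, (hfinal γ δ hne).2, (smul_eq_zero.mp h1).resolve_left hs, h2⟩
  · obtain ⟨γ, δ, hne, h2⟩ := hother Q₁
    have h1 := hpen γ δ
    rw [Submodule.coe_add, Submodule.coe_smul, Submodule.coe_smul, map_add, map_smul, map_smul, h2,
      smul_zero, zero_add] at h1
    exact ⟨_, (hfinal γ δ hne).1, (hfinal γ δ hne).2, h2, (smul_eq_zero.mp h1).resolve_left ht⟩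

end Form

/-! ### Inverse systems: functionals on forms and their contractions. -/

namespace Form

open MvPolynomial Module

variable {n : ℕ}

/-- The contraction of a functional with a linear form. -/
noncomputable def contract {k c : ℕ} (h : 1 + k = c) (g : Form n 1) :
    Dual ℝ (Form n c) →ₗ[ℝ] Dual ℝ (Form n k) := (mul h g).dualMap

theorem contract_apply {k c : ℕ} (h : 1 + k = c) (g : Form n 1) (l : Dual ℝ (Form n c))
    (f : Form n k) : contract h g l f = l (mul h g f) := rfl

/-- The contraction of a fixed functional, as a linear map. -/
noncomputable def contractLeft {k c : ℕ} (h : 1 + k = c) (l : Dual ℝ (Form n c)) :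
    Form n 1 →ₗ[ℝ] Dual ℝ (Form n k) where
  toFun g := contract h g l
  map_add' f g := LinearMap.ext fun x => by simp [contract_apply]
  map_smul' s g := LinearMap.ext fun x => by simp [contract_apply]

@[simp]
theorem contractLeft_apply {k c : ℕ} (h : 1 + k = c) (l : Dual ℝ (Form n c)) (g : Form n 1) :
    contractLeft h l g = contract h g l := rfl

theorem contract_comm {k c e : ℕ} (h : 1 + k = c) (h' : 1 + c = e) (f g : Form n 1)
    (l : Dual ℝ (Form n e)) :
    contract h f (contract h' g l) = contract h g (contract h' f l) := by
  refine LinearMap.ext fun x => ?_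
  simp only [contract_apply]
  congr 1
  exact Subtype.ext (by simp only [coe_mul]; ring)

/-- A functional all of whose contractions are proportional to values at a point is a multiple of
the evaluation. -/
theorem eq_smul_evalAt_of_contract {P : Fin n → ℝ} (hP : P ≠ 0) {k c : ℕ} (h : 1 + k = c)
    (l : Dual ℝ (Form n c)) (m : Dual ℝ (Form n k))
    (hl : ∀ g, contract h g l = evalAt 1 P g • m) : ∃ s : ℝ, l = s • evalAt c P := by
  suffices H : ∃ s : ℝ, m = s • evalAt k P by
    obtain ⟨s, rfl⟩ := H
    refine ⟨s, LinearMap.ext fun F => ?_⟩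
    induction F using induction_mul_linear h with
    | h0 => simp
    | hadd f g hf hg => rw [map_add, map_add, hf, hg]
    | hsmul a f hf => rw [map_smul, map_smul, hf]
    | hmul g f =>
      rw [← contract_apply, hl]
      simp only [LinearMap.smul_apply, evalAt_mul, smul_eq_mul]
      ring
  obtain ⟨u, hu⟩ := exists_linear_ne_zero hP
  induction k generalizing c with
  | zero =>
    refine ⟨m ⟨1, isHomogeneous_one _ _⟩, LinearMap.ext fun F => ?_⟩
    obtain ⟨F, hF⟩ := F
    have hF' := hF
    rw [mem_homogeneousSubmodule, ← totalDegree_zero_iff_isHomogeneous,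
      totalDegree_eq_zero_iff_eq_C] at hF'
    have : (⟨F, hF⟩ : Form n 0) = coeff 0 F • ⟨1, isHomogeneous_one _ _⟩ :=
      Subtype.ext (hF'.trans (by simp [smul_eq_C_mul]))
    rw [this, map_smul, map_smul]
    simp [evalAt_apply]
  | succ k ih =>
    -- Contractions commute, so m inherits the hypothesis on l one degree lower.
    have hm : ∀ g, contract (Nat.add_comm 1 k) g m =
        evalAt 1 P g • ((evalAt 1 P u)⁻¹ • contract (Nat.add_comm 1 k) u m) := by
      intro g
      have h1 := contract_comm (Nat.add_comm 1 k) h u g l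
      rw [hl, hl, map_smul, map_smul] at h1
      rw [smul_comm, h1, inv_smul_smul₀ hu]
    obtain ⟨s, hs⟩ := ih (Nat.add_comm 1 k) m _ hm
    refine ⟨s, LinearMap.ext fun F => ?_⟩
    induction F using induction_mul_linear (Nat.add_comm 1 k) with
    | h0 => simp
    | hadd f g hf hg => rw [map_add, map_add, hf, hg]
    | hsmul a f hf => rw [map_smul, map_smul, hf]
    | hmul g f =>
      rw [← contract_apply, hm, hs]
      simp only [LinearMap.smul_apply, evalAt_mul, smul_eq_mul]
      ring

/-- A functional killed by three independent linear forms in four variables is a multiple of the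
evaluation at their common zero. -/
theorem exists_eq_smul_evalAt {k c : ℕ} (h : 1 + k = c) (l : Dual ℝ (Form 4 c))
    {G : Fin 3 → Form 4 1} (hG : LinearIndependent ℝ G) (hGl : ∀ i, contract h (G i) l = 0) :
    ∃ P : Fin 4 → ℝ, P ≠ 0 ∧ (∀ i, evalAt 1 P (G i) = 0) ∧ ∃ s : ℝ, l = s • evalAt c P := by
  obtain ⟨P, hP, hP0⟩ := Submodule.exists_mem_ne_zero_of_ne_bot
    (LinearMap.ker_ne_bot_of_finrank_lt (f := LinearMap.pi fun i => toDual (G i)) (by simp))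
  have hGP : ∀ i, evalAt 1 P (G i) = 0 := fun i => congrFun hP i
  refine ⟨P, hP0, hGP, ?_⟩
  obtain ⟨u, hu⟩ := exists_linear_ne_zero hP0
  have hspan : Submodule.span ℝ (Set.range G) = LinearMap.ker (evalAt (n := 4) 1 P) := by
    refine Submodule.eq_of_le_of_finrank_le (Submodule.span_le.mpr ?_) ?_
    · rintro _ ⟨i, rfl⟩
      exact hGP i
    · rw [finrank_span_eq_card hG, Fintype.card_fin]
      have := Module.Dual.finrank_ker_add_one_of_ne_zero (f := evalAt (n := 4) 1 P)
        (fun h0 => hu (by rw [h0]; rfl))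
      rw [finrank_eq] at this
      simp at this
      omega
  have hker : Submodule.span ℝ (Set.range G) ≤ LinearMap.ker (contractLeft h l) :=
    Submodule.span_le.mpr (by rintro _ ⟨i, rfl⟩; exact hGl i)
  refine eq_smul_evalAt_of_contract hP0 h l ((evalAt 1 P u)⁻¹ • contract h u l) fun g => ?_
  have hmem : g - (evalAt 1 P g * (evalAt 1 P u)⁻¹) • u ∈ LinearMap.ker (contractLeft h l) := by
    refine hker (hspan ▸ ?_)
    simp [hu]
  rw [LinearMap.mem_ker, map_sub, map_smul, sub_eq_zero] at hmem
  rw [smul_smul]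
  exact hmem

section Quadrics

variable {v : Fin 8 → Fin 4 → ℝ} {q : Fin 3 → Form 4 2}

/-- The dot products with the points are nonzero linear forms in the coefficient vector, so a
generic vector avoids all their zeros. The resulting plane contains no common zero of the quadrics,
even over ℂ. -/
theorem exists_linear_avoiding {N : ℕ} {v : Fin N → Fin n → ℝ} (hv : DistinctProjectively v) :
    ∃ h : Form n 1, ∀ j, evalAt 1 (v j) h ≠ 0 := by
  let φ : (Fin n → ℝ) → Dual ℝ (Fin n → ℝ) := fun x => ∑ i, x i • LinearMap.proj i
  have hφ : ∀ x y, φ x y = ∑ i, x i * y i := fun x y => by simp [φ]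
  obtain ⟨a, ha⟩ := exists_forall_evalAt_ne_zero (fun j => ofDual (φ (v j))) fun j h0 => by
    have h1 := congrArg (evalAt 1 (v j)) h0
    rw [evalAt_ofDual, hφ, map_zero] at h1
    refine hv.1 j (funext fun i => ?_)
    exact mul_self_eq_zero.mp
      ((Finset.sum_eq_zero_iff_of_nonneg fun i _ => mul_self_nonneg _).mp h1 i (Finset.mem_univ i))
  refine ⟨ofDual (φ a), fun j => ?_⟩
  have := ha j
  rw [evalAt_ofDual, hφ] at this ⊢
  simpa only [mul_comm] using this

theorem no_zero_on_plane (hq : IsZeroLocus v q) {h : Form 4 1} (hh : ∀ j, evalAt 1 (v j) h ≠ 0)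
    {z : Fin 4 → ℂ} (hz : z ≠ 0) (hzh : aeval z h.1 = 0) (hzq : ∀ i, aeval z (q i).1 = 0) :
    False := by
  obtain ⟨j, c, hc, hg⟩ := hq.exists_linear_eq_zero hz hzq
  have := hg h
  rw [hzh] at this
  simp [hc, hh j] at this

theorem no_real_zero_on_plane (hq : IsZeroLocus v q) {h : Form 4 1}
    (hh : ∀ j, evalAt 1 (v j) h ≠ 0) {P : Fin 4 → ℝ} (hP : P ≠ 0) (hPh : evalAt 1 P h = 0) :
    ∃ i, evalAt 2 P (q i) ≠ 0 := by
  by_contra! H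
  refine no_zero_on_plane hq hh (z := fun i => (P i : ℂ)) (fun h0 => hP (funext fun i => by
    simpa using congrFun h0 i)) ?_ fun i => ?_
  · rw [aeval_ofReal, hPh, Complex.ofReal_zero]
  · rw [aeval_ofReal, H, Complex.ofReal_zero]

/-- Three quadrics in space with eight common zeros are linearly independent. -/
theorem linearIndependent_quadrics (hv : DistinctProjectively v) (hq : IsZeroLocus v q) :
    LinearIndependent ℝ q := by
  obtain ⟨h, hh⟩ := exists_linear_avoiding hv
  have hh0 : h ≠ 0 := by rintro rfl; simpa using hh 0
  rw [Fintype.linearIndependent_iff]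
  intro a ha
  by_contra! H
  obtain ⟨i, hi⟩ := H
  -- If one quadric depends on the other two, a common zero of those two on the plane h is a zero of
  -- all three, although the plane misses every point.
  obtain ⟨z, hz, hzh, h1, h2⟩ := exists_common_zero_on_plane (q (i.succAbove 0))
    (q (i.succAbove 1)) hh0
  have hother : ∀ k, aeval z (q (i.succAbove k)).1 = 0 := by
    intro k; fin_cases k <;> assumption
  refine no_zero_on_plane hq hh hz hzh fun j => ?_
  by_cases hji : j = i
  · subst hji
    have := congrArg (fun F : Form 4 2 => aeval z F.1) ha
    rw [Fin.sum_univ_succAbove _ j] at this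
    simp only [Submodule.coe_add, Submodule.coe_sum, Submodule.coe_smul, map_add, map_sum,
      map_smul, hother, smul_zero, Finset.sum_const_zero, add_zero, Submodule.coe_zero,
      map_zero] at this
    exact (smul_eq_zero.mp this).resolve_left hi
  · obtain ⟨k, rfl⟩ := Fin.exists_succAbove_eq hji
    exact hother k

/-- The functionals on quadrics that vanish on the given ones. -/
noncomputable def ann (q : Fin 3 → Form 4 2) : Submodule ℝ (Dual ℝ (Form 4 2)) :=
  (Submodule.span ℝ (Set.range q)).dualAnnihilator

theorem mem_ann {l : Dual ℝ (Form 4 2)} : l ∈ ann q ↔ ∀ i, l (q i) = 0 := by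
  rw [ann, Submodule.mem_dualAnnihilator]
  constructor
  · exact fun h i => h _ (Submodule.subset_span ⟨i, rfl⟩)
  · intro h w hw
    have : Submodule.span ℝ (Set.range q) ≤ LinearMap.ker l :=
      Submodule.span_le.mpr (by rintro _ ⟨i, rfl⟩; exact h i)
    exact this hw

/-- The functionals all of whose contractions lie in a given space. -/
noncomputable def prolong {k c : ℕ} (h : 1 + k = c) (A : Submodule ℝ (Dual ℝ (Form n k))) :
    Submodule ℝ (Dual ℝ (Form n c)) := ⨅ g, A.comap (contract h g)

theorem mem_prolong {k c : ℕ} {h : 1 + k = c} {A : Submodule ℝ (Dual ℝ (Form n k))}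
    {l : Dual ℝ (Form n c)} : l ∈ prolong h A ↔ ∀ g, contract h g l ∈ A := by
  simp [prolong]

theorem contract_mem_prolong {k c e : ℕ} {h : 1 + k = c} {h' : 1 + c = e}
    {A : Submodule ℝ (Dual ℝ (Form n k))} {l : Dual ℝ (Form n e)}
    (hl : l ∈ prolong h' (prolong h A)) (g : Form n 1) : contract h' g l ∈ prolong h A :=
  mem_prolong.mp hl g

/-- Multiples of evaluations at points of the plane do not vanish on the multiples of the given
quadrics. -/
theorem eq_zero_of_smul_evalAt_mem (hq : IsZeroLocus v q) {h : Form 4 1}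
    (hh : ∀ j, evalAt 1 (v j) h ≠ 0) {P : Fin 4 → ℝ} (hP : P ≠ 0) (hPh : evalAt 1 P h = 0)
    {s : ℝ} (hs : s • evalAt (n := 4) 3 P ∈ prolong (k := 2) rfl (ann q)) : s = 0 := by
  obtain ⟨i, hi⟩ := no_real_zero_on_plane hq hh hP hPh
  obtain ⟨g, hg⟩ := exists_linear_ne_zero hP
  have := mem_ann.mp (mem_prolong.mp hs g) i
  rw [contract_apply, LinearMap.smul_apply, evalAt_mul] at this
  simpa [hi, hg] using this

end Quadrics

end Form

theorem Submodule.finrank_le_one_of_combination {V : Type*} [AddCommGroup V] [Module ℝ V]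
    (K : Submodule ℝ V)
    (hK : ∀ x ∈ K, ∀ y ∈ K, ∃ s t : ℝ, (s ≠ 0 ∨ t ≠ 0) ∧ s • x + t • y = 0) :
    Module.finrank ℝ K ≤ 1 := by
  by_contra! H
  have : Nontrivial K := Module.nontrivial_of_finrank_pos (R := ℝ) (by omega)
  obtain ⟨x, hx⟩ := exists_ne (0 : K)
  obtain ⟨y, hy⟩ := exists_linearIndependent_pair_of_one_lt_finrank H hx
  obtain ⟨s, t, hst, h⟩ := hK x x.2 y y.2
  obtain ⟨hs, ht⟩ := LinearIndependent.pair_iff.mp hy s t (Subtype.ext h)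
  exact hst.elim (fun h => h hs) fun h => h ht

theorem Submodule.finrank_le_finrank_add_inf_ker {V W : Type*} [AddCommGroup V] [Module ℝ V]
    [FiniteDimensional ℝ V] [AddCommGroup W] [Module ℝ W] [FiniteDimensional ℝ W] (f : V →ₗ[ℝ] W)
    (A : Submodule ℝ V) (B : Submodule ℝ W) (hAB : ∀ l ∈ A, f l ∈ B) :
    Module.finrank ℝ A ≤ Module.finrank ℝ B + Module.finrank ℝ ↥(A ⊓ LinearMap.ker f) := by
  have h1 := LinearMap.finrank_range_add_finrank_ker (f.domRestrict A)
  have h2 : LinearMap.range (f.domRestrict A) ≤ B := by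
    rintro _ ⟨l, rfl⟩
    exact hAB l.1 l.2
  have h3 := Submodule.finrank_mono h2
  have h4 : Module.finrank ℝ (LinearMap.ker (f.domRestrict A)) ≤
      Module.finrank ℝ ↥(A ⊓ LinearMap.ker f) := by
    refine LinearMap.finrank_le_finrank_of_injective
      (f := (A.subtype ∘ₗ Submodule.subtype _).codRestrict _ fun l => ⟨l.1.2, l.2⟩) ?_
    intro a b hab
    exact Subtype.ext (Subtype.ext (congrArg (fun x => x.1) hab))
  omega

theorem Submodule.exists_pencil_apply_eq_zero {V W : Type*} [AddCommGroup V] [Module ℝ V]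
    [FiniteDimensional ℝ V] [AddCommGroup W] [Module ℝ W] [FiniteDimensional ℝ W]
    (E : Submodule ℝ V) (Q : Submodule ℝ W) (hEQ : Module.finrank ℝ E = Module.finrank ℝ Q)
    (hodd : Odd (Module.finrank ℝ E)) (A B : V →ₗ[ℝ] W) (hA : ∀ g ∈ E, A g ∈ Q)
    (hB : ∀ g ∈ E, B g ∈ Q) :
    ∃ s t : ℝ, (s ≠ 0 ∨ t ≠ 0) ∧ ∃ g ∈ E, g ≠ 0 ∧ s • A g + t • B g = 0 := by
  obtain ⟨s, t, hst, g, hg0, hg⟩ := LinearMap.exists_pencil_apply_eq_zero hEQ hodd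
    ((A.domRestrict E).codRestrict Q fun g => hA g.1 g.2)
    ((B.domRestrict E).codRestrict Q fun g => hB g.1 g.2)
  exact ⟨s, t, hst, g.1, g.2, fun h => hg0 (Subtype.ext h), congrArg Subtype.val hg⟩

/-! ### The Hilbert function of three quadrics with eight common zeros. -/

namespace Form

open MvPolynomial Module

variable {v : Fin 8 → Fin 4 → ℝ} {q : Fin 3 → Form 4 2}

/-- A multiple h m in the span of the quadrics vanishes at all points, and h at none, so m vanishes
at five points that are not coplanar and is 0. The count is 10 - (3 + 4). -/
theorem finrank_ann_inf_ker (hv : DistinctProjectively v) (hq : IsZeroLocus v q)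
    (hp : NoneOnHypersurface 5 1 v) {h : Form 4 1} (hh : ∀ j, evalAt 1 (v j) h ≠ 0) :
    finrank ℝ ↥(ann q ⊓ LinearMap.ker (contract (k := 1) (c := 2) rfl h)) = 3 := by
  have hinj : Function.Injective (mul (b := 1) (c := 2) rfl h) := by
    refine (injective_iff_map_eq_zero _).mpr fun m hm => ?_
    have h1 : h.1 * m.1 = 0 := congrArg Subtype.val hm
    refine Subtype.ext ((mul_eq_zero.mp h1).resolve_left fun h0 => hh 0 ?_)
    rw [evalAt_apply, h0, map_zero]
  have hinf : Submodule.span ℝ (Set.range q) ⊓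
      LinearMap.range (mul (b := 1) (c := 2) rfl h) = ⊥ := by
    rw [eq_bot_iff]
    rintro _ ⟨h1, m, rfl⟩
    have hm : m = 0 := by
      refine hp {0, 1, 2, 3, 4} (by decide) m fun j _ => ?_
      have h2 : Submodule.span ℝ (Set.range q) ≤ LinearMap.ker (evalAt 2 (v j)) :=
        Submodule.span_le.mpr (by rintro _ ⟨i, rfl⟩; exact hq.evalAt_eq_zero hv i j)
      have h3 : evalAt 2 (v j) (mul rfl h m) = 0 := h2 h1
      rw [evalAt_mul] at h3
      exact (mul_eq_zero.mp h3).resolve_left (hh j)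
    simp [hm]
  have h1 := Submodule.finrank_sup_add_finrank_inf_eq (Submodule.span ℝ (Set.range q))
    (LinearMap.range (mul (b := 1) (c := 2) rfl h))
  rw [hinf, finrank_bot, finrank_span_eq_card (linearIndependent_quadrics hv hq),
    LinearMap.finrank_range_of_inj hinj, Fintype.card_fin, finrank_eq] at h1
  have h2 := Subspace.finrank_add_finrank_dualAnnihilator_eq
    (Submodule.span ℝ (Set.range q) ⊔ LinearMap.range (mul (b := 1) (c := 2) rfl h))
  rw [Submodule.dualAnnihilator_sup_eq, ← LinearMap.ker_dualMap_eq_dualAnnihilator_range,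
    finrank_eq] at h2
  change _ + finrank ℝ ↥(ann q ⊓ LinearMap.ker (contract (k := 1) (c := 2) rfl h)) = _ at h2
  norm_num [Nat.choose] at h1 h2
  omega

/-- Functionals on the quadrics on a line. -/
theorem apply_eq_of_contract {e₁ e₂ : Fin 4 → ℝ} {m₁ m₂ : Form 4 1} {l : Dual ℝ (Form 4 2)}
    (hl : ∀ g : Form 4 1, contract (k := 1) rfl g l =
      evalAt 1 e₁ g • contract (k := 1) rfl m₁ l + evalAt 1 e₂ g • contract (k := 1) rfl m₂ l)
    (F : Form 4 2) : l F = evalAt 2 e₁ F * l (mul rfl m₁ m₁) + polar e₁ e₂ F * l (mul rfl m₁ m₂) +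
      evalAt 2 e₂ F * l (mul rfl m₂ m₂) := by
  have hcomm : mul (rfl : 1 + 1 = 2) m₂ m₁ = mul rfl m₁ m₂ := Subtype.ext (mul_comm _ _)
  have hl' : ∀ g f : Form 4 1, l (mul rfl g f) =
      evalAt 1 e₁ g * l (mul rfl m₁ f) + evalAt 1 e₂ g * l (mul rfl m₂ f) := fun g f =>
    LinearMap.congr_fun (hl g) f
  have hl'' : ∀ m f : Form 4 1, l (mul rfl m f) =
      evalAt 1 e₁ f * l (mul rfl m m₁) + evalAt 1 e₂ f * l (mul rfl m m₂) := fun m f => by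
    rw [show mul (rfl : 1 + 1 = 2) m f = mul rfl f m from Subtype.ext (mul_comm _ _), hl',
      show mul (rfl : 1 + 1 = 2) m₁ m = mul rfl m m₁ from Subtype.ext (mul_comm _ _),
      show mul (rfl : 1 + 1 = 2) m₂ m = mul rfl m m₂ from Subtype.ext (mul_comm _ _)]
  induction F using induction_mul_linear (k := 1) rfl with
  | h0 => simp
  | hadd f g hf hg => simp only [map_add, hf, hg]; ring
  | hsmul c f hf => simp only [map_smul, hf, smul_eq_mul]; ring
  | hmul g f =>
    rw [hl', hl'' m₁ f, hl'' m₂ f, hcomm, evalAt_mul, evalAt_mul, polar_mul]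
    ring

/-- A functional on cubics that vanishes on the multiples of the quadrics and is killed by two
independent linear forms is zero. -/
theorem eq_zero_of_contract_pair (hq : IsZeroLocus v q)
    {h : Form 4 1} (hh : ∀ j, evalAt 1 (v j) h ≠ 0) {g : Form 4 1}
    (hgh : LinearIndependent ℝ ![g, h]) {l : Dual ℝ (Form 4 3)}
    (hl : l ∈ prolong (k := 2) rfl (ann q)) (hlh : contract (k := 2) rfl h l = 0)
    (hlg : contract (k := 2) rfl g l = 0) : l = 0 := by
  by_contra hl0
  let E := LinearMap.ker (LinearMap.pi ![toDual h, toDual g])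
  have hE : 2 ≤ finrank ℝ E := by
    have h1 := LinearMap.finrank_range_add_finrank_ker (LinearMap.pi ![toDual h, toDual g])
    have h2 := Submodule.finrank_le (LinearMap.range (LinearMap.pi ![toDual h, toDual g]))
    simp only [finrank_fintype_fun_eq_card, Fintype.card_fin] at h1 h2
    change _ + finrank ℝ E = _ at h1
    omega
  have hEh : ∀ e : E, evalAt 1 e.1 h = 0 := fun e => congrFun e.2 0
  have hEg : ∀ e : E, evalAt 1 e.1 g = 0 := fun e => congrFun e.2 1
  have : Nontrivial E := Module.nontrivial_of_finrank_pos (R := ℝ) (by omega)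
  obtain ⟨e₁, he₁⟩ := exists_ne (0 : E)
  obtain ⟨e₂, he⟩ := exists_linearIndependent_pair_of_one_lt_finrank (R := ℝ) (by omega) he₁
  have hli : LinearIndependent ℝ ![e₁.1, e₂.1] := by
    convert! he.map' E.subtype (Submodule.ker_subtype E) using 1
    funext i
    fin_cases i <;> rfl
  have hrel : ∀ w : Fin 2 → ℝ,
      (∀ f : Form 4 1, ∑ j, w j * evalAt 1 (![e₁.1, e₂.1] j) f = 0) → w = 0 := fun w hw =>
    funext (Fintype.linearIndependent_iff.mp hli w (sum_smul_eq_zero hw))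
  have hdual : ∀ x : Fin 2 → ℝ, ∃ m : Form 4 1, evalAt 1 e₁.1 m = x 0 ∧ evalAt 1 e₂.1 m = x 1 := by
    intro x
    obtain ⟨m, hm⟩ := exists_evalAt_eq ![e₁.1, e₂.1] x fun w hw => by simp [hrel w hw]
    exact ⟨m, hm 0, hm 1⟩
  obtain ⟨m₁, hm₁₁, hm₁₂⟩ := hdual ![1, 0]
  obtain ⟨m₂, hm₂₁, hm₂₂⟩ := hdual ![0, 1]
  simp only [Matrix.cons_val_zero, Matrix.cons_val_one] at hm₁₁ hm₁₂ hm₂₁ hm₂₂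
  have hspan : Submodule.span ℝ (Set.range ![g, h]) =
      LinearMap.ker (LinearMap.pi fun j => evalAt 1 (![e₁.1, e₂.1] j)) := by
    refine Submodule.eq_of_le_of_finrank_le (Submodule.span_le.mpr ?_) ?_
    · rintro _ ⟨i, rfl⟩
      refine funext fun j => ?_
      fin_cases i <;> fin_cases j
      · exact hEg e₁
      · exact hEg e₂
      · exact hEh e₁
      · exact hEh e₂
    · have h1 := finrank_vanishing (d := 1) ![e₁.1, e₂.1] hrel
      rw [finrank_eq, Fintype.card_fin] at h1
      rw [finrank_span_eq_card hgh, Fintype.card_fin]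
      norm_num [Nat.choose] at h1
      omega
  -- The functional l lives on the line g = h = 0: contraction with f depends only on the values of
  -- f at the basis `e₁`, `e₂`.
  have hcl : ∀ f : Form 4 1, contract (k := 2) rfl f l =
      evalAt 1 e₁.1 f • contract (k := 2) rfl m₁ l +
          evalAt 1 e₂.1 f • contract (k := 2) rfl m₂ l := by
    intro f
    have hker : Submodule.span ℝ (Set.range ![g, h]) ≤
        LinearMap.ker (contractLeft (k := 2) rfl l) := by
      refine Submodule.span_le.mpr ?_
      rintro _ ⟨i, rfl⟩
      fin_cases i
      · exact hlg
      · exact hlh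
    have hmem : f - (evalAt 1 e₁.1 f • m₁ + evalAt 1 e₂.1 f • m₂) ∈
        LinearMap.ker (contractLeft (k := 2) rfl l) := by
      refine hker (hspan ▸ ?_)
      refine funext fun j => ?_
      fin_cases j
      · simp [hm₁₁, hm₂₁]
      · simp [hm₁₂, hm₂₂]
    rw [LinearMap.mem_ker, map_sub, sub_eq_zero, map_add, map_smul, map_smul] at hmem
    exact hmem
  -- A third independent linear form killing l would make it a multiple of an evaluation at a point
  -- of the plane h, where some quadric is nonzero.
  have hthird : ∀ s t : ℝ, contract (k := 2) rfl (s • m₁ + t • m₂) l = 0 → s = 0 ∧ t = 0 := by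
    intro s t hst
    by_contra hne
    have hG : LinearIndependent ℝ ![s • m₁ + t • m₂, g, h] := by
      rw [Fintype.linearIndependent_iff]
      intro a ha
      rw [Fin.sum_univ_three] at ha
      change a 0 • (s • m₁ + t • m₂) + a 1 • g + a 2 • h = 0 at ha
      have h1 := congrArg (evalAt 1 e₁.1) ha
      have h2 := congrArg (evalAt 1 e₂.1) ha
      simp only [map_add, map_smul, hm₁₁, hm₁₂, hm₂₁, hm₂₂, hEg, hEh, map_zero, smul_eq_mul]
          at h1 h2
      have h0 : a 0 = 0 := by
        by_contra h0
        refine hne ⟨?_, ?_⟩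
        · simpa [h0] using h1
        · simpa [h0] using h2
      rw [h0, zero_smul, zero_add] at ha
      obtain ⟨h3, h4⟩ := LinearIndependent.pair_iff.mp hgh _ _ ha
      intro i
      fin_cases i <;> assumption
    obtain ⟨P, hP, hGP, r, hr⟩ := exists_eq_smul_evalAt (k := 2) rfl l hG (by
      intro i
      fin_cases i
      · exact hst
      · exact hlg
      · exact hlh)
    have := eq_zero_of_smul_evalAt_mem hq hh hP (hGP 2) (hr ▸ hl)
    rw [this, zero_smul] at hr
    exact hl0 hr
  -- Restriction to the line, as coefficients of a binary quadratic. The contractions of l with `m₁`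
  -- and `m₂` become two independent functionals annihilating the restricted quadrics, which leaves
  -- these at most one dimension out of three.
  let r : Form 4 2 →ₗ[ℝ] (Fin 3 → ℝ) :=
    LinearMap.pi ![evalAt 2 e₁.1, polar e₁.1 e₂.1, evalAt 2 e₂.1]
  let φ : Form 4 1 → Dual ℝ (Fin 3 → ℝ) := fun m =>
    contract (k := 2) rfl m l (mul rfl m₁ m₁) • LinearMap.proj 0 +
    contract (k := 2) rfl m l (mul rfl m₁ m₂) • LinearMap.proj 1 +
    contract (k := 2) rfl m l (mul rfl m₂ m₂) • LinearMap.proj 2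
  have hφ : ∀ m F, φ m (r F) = contract (k := 2) rfl m l F := by
    intro m F
    rw [apply_eq_of_contract (e₁ := e₁.1) (e₂ := e₂.1) (m₁ := m₁) (m₂ := m₂)
      (l := contract (k := 2) rfl m l) (fun f => ?_) F]
    · change _ * (r F) 0 + _ * (r F) 1 + _ * (r F) 2 = _
      simp only [r, LinearMap.pi_apply, Matrix.cons_val_zero, Matrix.cons_val_one,
        Matrix.cons_val]
      ring
    · rw [contract_comm, hcl f, map_add, map_smul, map_smul, contract_comm _ _ m m₁,
        contract_comm _ _ m m₂]
  let R := Submodule.span ℝ (Set.range fun i => r (q i))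
  have hφR : ∀ m, φ m ∈ R.dualAnnihilator := by
    intro m
    rw [Submodule.mem_dualAnnihilator]
    intro w hw
    have : R ≤ LinearMap.ker (φ m) := by
      refine Submodule.span_le.mpr ?_
      rintro _ ⟨i, rfl⟩
      exact (hφ m (q i)).trans (mem_ann.mp (mem_prolong.mp hl m) i)
    exact this hw
  have hφli : LinearIndependent ℝ ![φ m₁, φ m₂] := by
    rw [LinearIndependent.pair_iff]
    intro s t hst
    refine hthird s t (LinearMap.ext fun F => ?_)
    have h1 := LinearMap.congr_fun hst (r F)
    simp only [LinearMap.add_apply, LinearMap.smul_apply, hφ, LinearMap.zero_apply] at h1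
    rw [← contractLeft_apply, map_add, map_smul, map_smul]
    exact h1
  have hR : finrank ℝ R ≤ 1 := by
    have h1 : Submodule.span ℝ (Set.range ![φ m₁, φ m₂]) ≤ R.dualAnnihilator := by
      refine Submodule.span_le.mpr ?_
      rintro _ ⟨i, rfl⟩
      fin_cases i
      · exact hφR m₁
      · exact hφR m₂
    have h2 := Submodule.finrank_mono h1
    have h3 := Subspace.finrank_add_finrank_dualAnnihilator_eq R
    rw [finrank_span_eq_card hφli, Fintype.card_fin] at h2
    simp only [finrank_fintype_fun_eq_card, Fintype.card_fin] at h3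
    omega
  obtain ⟨⟨ρ, hρ⟩, hρ'⟩ := finrank_le_one_iff.mp hR
  -- All restricted quadrics are multiples of ρ, so a complex zero of ρ is a common zero of them on
  -- the plane h.
  obtain ⟨x, y, hxy, h0⟩ := Complex.exists_binary_quadratic_zero (ρ 0 : ℂ) (ρ 1 : ℂ) (ρ 2 : ℂ)
  refine no_zero_on_plane hq hh (z := x • (fun i => (e₁.1 i : ℂ)) + y • (fun i => (e₂.1 i : ℂ)))
    ?_ ?_ ?_
  · intro hz
    have := hli.complex_combination (c := ![x, y]) (by rw [Fin.sum_univ_two]; exact hz)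
    have hx : x = 0 := this 0
    have hy : y = 0 := this 1
    simp [hx, hy] at hxy
  · rw [aeval_linear_combination, aeval_ofReal, aeval_ofReal, hEh, hEh]
    simp
  · intro i
    obtain ⟨c, hc⟩ := hρ' ⟨r (q i), Submodule.subset_span ⟨i, rfl⟩⟩
    have hc' : c • ρ = r (q i) := congrArg Subtype.val hc
    have c0 : evalAt 2 e₁.1 (q i) = c * ρ 0 := (congrFun hc' 0).symm
    have c1 : polar e₁.1 e₂.1 (q i) = c * ρ 1 := (congrFun hc' 1).symm
    have c2 : evalAt 2 e₂.1 (q i) = c * ρ 2 := (congrFun hc' 2).symm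
    have hz := aeval_quadratic (q i) e₁.1 e₂.1 e₂.1 x y 0
    rw [zero_smul, add_zero] at hz
    rw [hz, c0, c1, c2]
    simp only [Complex.ofReal_mul]
    linear_combination (c : ℂ) * h0

/-- Two functionals on cubics that vanish on the ideal of the quadrics and a plane are
proportional. -/
theorem exists_combination_eq_zero (hv : DistinctProjectively v) (hq : IsZeroLocus v q)
    (hp : NoneOnHypersurface 5 1 v) {h : Form 4 1} (hh : ∀ j, evalAt 1 (v j) h ≠ 0)
    {l₁ l₂ : Dual ℝ (Form 4 3)} (hl₁ : l₁ ∈ prolong (k := 2) rfl (ann q))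
    (hl₂ : l₂ ∈ prolong (k := 2) rfl (ann q)) (hl₁' : contract (k := 2) rfl h l₁ = 0)
    (hl₂' : contract (k := 2) rfl h l₂ = 0) :
    ∃ s t : ℝ, (s ≠ 0 ∨ t ≠ 0) ∧ s • l₁ + t • l₂ = 0 := by
  have hh0 : h ≠ 0 := by rintro rfl; simpa using hh 0
  obtain ⟨E, hE⟩ := Submodule.exists_isCompl (Submodule.span ℝ {h})
  have hEdim : finrank ℝ E = 3 := by
    have := Submodule.finrank_add_eq_of_isCompl hE
    rw [finrank_span_singleton hh0, finrank_eq] at this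
    norm_num [Nat.choose] at this
    omega
  have hodd : Odd (finrank ℝ E) := hEdim ▸ by decide
  have hmap : ∀ l : Dual ℝ (Form 4 3), l ∈ prolong (k := 2) rfl (ann q) →
      contract (k := 2) rfl h l = 0 → ∀ g ∈ E, contractLeft (k := 2) rfl l g ∈
      ann q ⊓ LinearMap.ker (contract (k := 1) (c := 2) rfl h) := by
    refine fun l hl hl' g _ => ⟨mem_prolong.mp hl g, ?_⟩
    rw [SetLike.mem_coe, LinearMap.mem_ker, contractLeft_apply, contract_comm, hl', map_zero]
  -- Contraction of `l₁` and `l₂` gives two maps between spaces of the odd dimension 3. A singular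
  -- member yields a combination killed by both h and an independent g.
  obtain ⟨s, t, hst, g, hgE, hg0, hg⟩ := Submodule.exists_pencil_apply_eq_zero E _
    (hEdim.trans (finrank_ann_inf_ker hv hq hp hh).symm) hodd _ _ (hmap l₁ hl₁ hl₁')
    (hmap l₂ hl₂ hl₂')
  have hgh : LinearIndependent ℝ ![g, h] := by
    rw [LinearIndependent.pair_iff]
    intro a b hab
    have h1 : a • g ∈ Submodule.span ℝ {h} := Submodule.mem_span_singleton.mpr
      ⟨-b, by rw [neg_smul]; exact (eq_neg_of_add_eq_zero_left hab).symm⟩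
    have h2 := Submodule.disjoint_def.mp hE.disjoint _ h1 (E.smul_mem a hgE)
    have ha : a = 0 := (smul_eq_zero.mp h2).resolve_right hg0
    rw [ha, zero_smul, zero_add] at hab
    exact ⟨ha, (smul_eq_zero.mp hab).resolve_right hh0⟩
  refine ⟨s, t, hst, eq_zero_of_contract_pair hq hh hgh
    (Submodule.add_mem _ (Submodule.smul_mem _ s hl₁) (Submodule.smul_mem _ t hl₂)) ?_ ?_⟩
  · rw [map_add, map_smul, map_smul, hl₁', hl₂', smul_zero, smul_zero, add_zero]
  · rw [map_add, map_smul, map_smul]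
    exact hg

/-- The cubics modulo the quadrics and a plane have dimension at most one. -/
theorem finrank_ker_contract_cubics (hv : DistinctProjectively v) (hq : IsZeroLocus v q)
    (hp : NoneOnHypersurface 5 1 v) {h : Form 4 1} (hh : ∀ j, evalAt 1 (v j) h ≠ 0) :
    finrank ℝ ↥(prolong (k := 2) (c := 3) rfl (ann q) ⊓
      LinearMap.ker (contract (k := 2) (c := 3) rfl h)) ≤ 1 := by
  refine Submodule.finrank_le_one_of_combination _ fun l₁ hl₁ l₂ hl₂ => ?_
  exact exists_combination_eq_zero hv hq hp hh hl₁.1 hl₂.1 hl₁.2 hl₂.2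

/-- Every quartic is in the ideal of the quadrics and the plane. -/
theorem eq_zero_of_contract_quartics (hv : DistinctProjectively v) (hq : IsZeroLocus v q)
    (hp : NoneOnHypersurface 5 1 v) {h : Form 4 1} (hh : ∀ j, evalAt 1 (v j) h ≠ 0)
    {l : Dual ℝ (Form 4 4)} (hl : l ∈ prolong (k := 3) rfl (prolong (k := 2) rfl (ann q)))
    (hlh : contract (k := 3) rfl h l = 0) : l = 0 := by
  have hh0 : h ≠ 0 := by rintro rfl; simpa using hh 0
  have hrange : LinearMap.range (contractLeft (k := 3) rfl l) ≤
      prolong (k := 2) rfl (ann q) ⊓ LinearMap.ker (contract (k := 2) (c := 3) rfl h) := by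
    rintro _ ⟨g, rfl⟩
    refine ⟨contract_mem_prolong hl g, ?_⟩
    rw [SetLike.mem_coe, LinearMap.mem_ker, contractLeft_apply, contract_comm, hlh, map_zero]
  -- Contraction maps the four-dimensional space of linear forms into dimension at most 1, so three
  -- independent linear forms, h among them, kill l.
  have h1 := (Submodule.finrank_mono hrange).trans (finrank_ker_contract_cubics hv hq hp hh)
  have h2 := LinearMap.finrank_range_add_finrank_ker (contractLeft (k := 3) rfl l)
  rw [finrank_eq] at h2
  norm_num [Nat.choose] at h2
  obtain ⟨y, hy, z, hz, hli⟩ :=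
      (LinearMap.ker (contractLeft (k := 3) rfl l)).exists_linearIndependent_triple
    (by omega) (x := h) hlh hh0
  obtain ⟨P, hP, hGP, s, hs⟩ := exists_eq_smul_evalAt (k := 3) rfl l hli (by
    intro i
    fin_cases i
    · exact hz
    · exact hy
    · exact hlh)
  obtain ⟨g, hg⟩ := exists_linear_ne_zero hP
  have hcon : contract (k := 3) rfl g l = (s * evalAt 1 P g) • evalAt 3 P := by
    refine LinearMap.ext fun F => ?_
    rw [contract_apply, hs]
    simp only [LinearMap.smul_apply, evalAt_mul, smul_eq_mul]
    ring
  have := eq_zero_of_smul_evalAt_mem hq hh hP (hGP 2) (hcon ▸ contract_mem_prolong hl g)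
  have hs0 : s = 0 := (mul_eq_zero.mp this).resolve_right hg
  rw [hs, hs0, zero_smul]

theorem finrank_le_of_contract {k c : ℕ} (hkc : 1 + k = c) (h : Form 4 1)
    (A : Submodule ℝ (Dual ℝ (Form 4 c))) (B : Submodule ℝ (Dual ℝ (Form 4 k)))
    (hAB : ∀ l ∈ A, contract hkc h l ∈ B) :
    finrank ℝ A ≤ finrank ℝ B + finrank ℝ ↥(A ⊓ LinearMap.ker (contract hkc h)) :=
  Submodule.finrank_le_finrank_add_inf_ker _ A B hAB

/-- The eight points of intersection of three quadrics. -/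
theorem isCayleyBacharachConfig_quadrics (hv : DistinctProjectively v) (hq : IsZeroLocus v q)
    (hp : NoneOnHypersurface 5 1 v) : IsCayleyBacharachConfig 2 6 v q := by
  have hli := linearIndependent_quadrics hv hq
  refine isCayleyBacharachConfig two_ne_zero hv (hq.evalAt_eq_zero hv)
    (fun w hw j hj => eq_zero_of_relation (fun τ hτ w hw =>
      quadric_relation_head (hv.comp hτ) (hp.comp hτ) hw) w hw j hj) hli
    (by rw [finrank_eq]; rfl) ?_
  obtain ⟨h, hh⟩ := exists_linear_avoiding hv
  have h2 := Subspace.finrank_add_finrank_dualAnnihilator_eq (Submodule.span ℝ (Set.range q))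
  rw [finrank_span_eq_card hli, Fintype.card_fin, finrank_eq] at h2
  change 3 + finrank ℝ (ann q) = _ at h2
  norm_num [Nat.choose] at h2
  have h3 := finrank_le_of_contract (k := 2) rfl h (prolong (k := 2) (c := 3) rfl (ann q)) (ann q)
    fun l hl => mem_prolong.mp hl h
  have h3' := finrank_ker_contract_cubics hv hq hp hh
  have h4 := finrank_le_of_contract (k := 3) rfl h
    (prolong (k := 3) rfl (prolong (k := 2) rfl (ann q))) _ fun l hl => contract_mem_prolong hl h
  have h4' : prolong (k := 3) rfl (prolong (k := 2) rfl (ann q)) ⊓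
      LinearMap.ker (contract (k := 3) (c := 4) rfl h) = ⊥ :=
    eq_bot_iff.mpr fun l hl => eq_zero_of_contract_quartics hv hq hp hh hl.1 hl.2
  rw [h4', finrank_bot] at h4
  -- Functionals on quartics annihilating the ideal are bounded by 7 in degree 2, then 7 + 1 in
  -- degree 3, then 8 + 0 in degree 4.
  have h5 : (LinearMap.range (combination q)).dualAnnihilator ≤
      prolong (k := 3) rfl (prolong (k := 2) rfl (ann q)) := by
    intro l hl
    rw [mem_prolong]
    intro g
    rw [mem_prolong]
    intro f
    rw [mem_ann]
    intro i
    rw [Submodule.mem_dualAnnihilator] at hl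
    refine Eq.trans ?_ (hl _ ⟨Pi.single i (mul rfl g f), rfl⟩)
    rw [combination_apply, Finset.sum_eq_single i]
    · rw [contract_apply, contract_apply]
      refine congrArg l (Subtype.ext ?_)
      simp only [coe_mul, Pi.single_eq_same]
      ring
    · intro j _ hj
      simp [hj]
    · simp
  have hdim3 : finrank ℝ ↥(prolong (k := 2) (c := 3) rfl (ann q)) ≤ 8 := by
    refine h3.trans ?_
    have h7 := Nat.add_le_add_left h3' (finrank ℝ (ann q))
    refine h7.trans ?_
    omega
  have hdim4 : finrank ℝ ↥(prolong (k := 3) (c := 4) rfl (prolong (k := 2) (c := 3) rfl (ann q)))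
      ≤ 8 := h4.trans hdim3
  have h5' : finrank ℝ (LinearMap.range (combination q)).dualAnnihilator ≤ 8 :=
    (Submodule.finrank_mono h5).trans hdim4
  have h6 := Subspace.finrank_add_finrank_dualAnnihilator_eq (LinearMap.range (combination q))
  change _ + finrank ℝ (LinearMap.range (combination q)).dualAnnihilator = _ at h6
  omega

end Form

/-! ### The two cases: nine points of two cubics, eight points of three quadrics. -/

theorem theorem4p1 :
    -- ternary sextics with seven zeros
    (∀ (p : Form 3 (2 * 3)) (v : Fin 9 → Fin 3 → ℝ),
      p ∈ frontier (Form.psdCone 3 (2 * 3)) →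
      p ∉ Form.sosCone 3 3 →
      Form.DistinctProjectively v →
      Form.IsIntersection 2 3 v →
      Form.NoneOnHypersurface 4 1 v →
      Form.NoneOnHypersurface 7 2 v →
      Form.HasZeroSet p (fun j : Fin 7 => v (Fin.castAdd 2 j)) →
      (∃ u : Fin 9 → ℝ, Form.IsCayleyBacharach 3 v u ∧ (∀ j, u j ≠ 0) ∧
        ∀ u' : Fin 9 → ℝ, Form.IsCayleyBacharach 3 v u' → ∃ c : ℝ, u' = c • u) ∧
      (∀ u : Fin 9 → ℝ, Form.IsCayleyBacharach 3 v u →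
        (u 7 ^ 2 * Form.evalAt (2 * 3) (v 7) p ≠ u 8 ^ 2 * Form.evalAt (2 * 3) (v 8) p →
          ∃ a : Fin 9 → ℝ,
            Form.pointFunctional (2 * 3) v a ∈ Form.sosDual 3 3 ∧
            Form.pointFunctional (2 * 3) v a p < 0 ∧
            Form.SpansExtremeRay (Form.sosDual 3 3) (Form.pointFunctional (2 * 3) v a)) ∧
        (u 7 ^ 2 * Form.evalAt (2 * 3) (v 7) p = u 8 ^ 2 * Form.evalAt (2 * 3) (v 8) p ↔
          p ∈ Form.productSpan 3 (fun j : Fin 7 => v (Fin.castAdd 2 j)))) ∧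
      Form.productSpan 3 (fun j : Fin 7 => v (Fin.castAdd 2 j)) <
        Form.singularForms (2 * 3) (fun j : Fin 7 => v (Fin.castAdd 2 j)))
    ∧
    -- quaternary quartics with six zeros
    (∀ (p : Form 4 (2 * 2)) (v : Fin 8 → Fin 4 → ℝ),
      p ∈ frontier (Form.psdCone 4 (2 * 2)) →
      p ∉ Form.sosCone 4 2 →
      Form.DistinctProjectively v →
      Form.IsIntersection 3 2 v →
      Form.NoneOnHypersurface 5 1 v →
      Form.HasZeroSet p (fun j : Fin 6 => v (Fin.castAdd 2 j)) →
      (∃ u : Fin 8 → ℝ, Form.IsCayleyBacharach 2 v u ∧ (∀ j, u j ≠ 0) ∧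
        ∀ u' : Fin 8 → ℝ, Form.IsCayleyBacharach 2 v u' → ∃ c : ℝ, u' = c • u) ∧
      (∀ u : Fin 8 → ℝ, Form.IsCayleyBacharach 2 v u →
        (u 6 ^ 2 * Form.evalAt (2 * 2) (v 6) p ≠ u 7 ^ 2 * Form.evalAt (2 * 2) (v 7) p →
          ∃ a : Fin 8 → ℝ,
            Form.pointFunctional (2 * 2) v a ∈ Form.sosDual 4 2 ∧
            Form.pointFunctional (2 * 2) v a p < 0 ∧
            Form.SpansExtremeRay (Form.sosDual 4 2) (Form.pointFunctional (2 * 2) v a)) ∧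
        (u 6 ^ 2 * Form.evalAt (2 * 2) (v 6) p = u 7 ^ 2 * Form.evalAt (2 * 2) (v 7) p ↔
          p ∈ Form.productSpan 2 (fun j : Fin 6 => v (Fin.castAdd 2 j)))) ∧
      Form.productSpan 2 (fun j : Fin 6 => v (Fin.castAdd 2 j)) <
        Form.singularForms (2 * 2) (fun j : Fin 6 => v (Fin.castAdd 2 j))) := by
  refine ⟨fun p v hp _ hv hI hl hc hz => ?_, fun p v hp _ hv hI hpl hz => ?_⟩
  · obtain ⟨q, hq⟩ := hI
    exact (Form.isCayleyBacharachConfig_cubics hv hq hl hc).main rfl (by norm_num) (by norm_num)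
      (by rw [Form.finrank_eq]; decide) hp hz
  · obtain ⟨q, hq⟩ := hI
    exact (Form.isCayleyBacharachConfig_quadrics hv hq hpl).main rfl (by norm_num) (by norm_num)
      (by rw [Form.finrank_eq]; decide) hp hz
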